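/- \textbf{Definitions.} Let $m\ge 0$ be an integer. A group $G$ is \emph{biextraspecial of rank $m$} if it has a normal subgroup $Q$ of order $2^{2+2m}$ with $G/Q\cong L:=L_2(2)=\mathrm{SL}_2(2)$ such that, for the conjugation action, (i) the centre $Z$ of $Q$ is the natural $L$-module $\mathrm{GF}(2)^2$; (ii) $Q/Z$ is elementary abelian, and every composition factor of the $L$-module $Q/Z$ is isomorphic to the natural $L$-module. A \emph{dent} of $G$ is a normal subgroup $D$ of $G$ with $Z<D<Q$ such that $D/Z$ is an irreducible $L$-submodule of $Q/Z$. For distinct dents $D_1,D_2$, let $\varphi:D_1/Z\to D_2/Z$ be the $L$-isomorphism (it is unique) and let $D_1+D_2$ be the full preimage in $Q$ of $\{x\,\varphi(x): x\in D_1/Z\}$. Adjoining a formal zero $0$, neutral for $+$, and putting $D+D=0$, the dents form a vector space over $\mathrm{GF}(2)$, the \emph{dent space} of $G$. It carries the quadratic form $q$ with $q(0)=0$, $q(D)=0$ if $D\cong 2^4$ (elementary abelian of order $16$), and $q(D)=1$ otherwise. The \emph{type} of $G$ is the type of $q$: it is $+$ if $q$ is isometric to an orthogonal sum of hyperbolic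 planes (form $xy$), and $-$ if $q$ is isometric to an orthogonal sum of hyperbolic planes and one anisotropic plane (form $x^2+xy+y^2$). \textbf{Theorem.} For every even positive integer $m$ and each type $\varepsilon\in\{+,-\}$, there exists a biextraspecial group of rank $m$ and type $\varepsilon$, and any two biextraspecial groups of rank $m$ and type $\varepsilon$ are isomorphic. -/

import Mathlib

namespace Biextraspecial

/-- The group `L₂(2) = SL₂(2)`. -/
abbrev L22 : Type := Matrix.SpecialLinearGroup (Fin 2) (ZMod 2)

/-- The underlying group of the natural `L₂(2)`-module, column vectors of length two over `GF(2)`. -/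
abbrev NatMod : Type := Fin 2 → ZMod 2

section Structure

variable {G : Type*} [Group G]

/-- The centre `Z` of the subgroup `Q`, as a subgroup of `G`. -/
def Z (Q : Subgroup G) : Subgroup G := (Subgroup.center Q).map Q.subtype

instance Z_normal (Q : Subgroup G) [hQ : Q.Normal] : (Z Q).Normal := by
  unfold Z; infer_instance

/-- For normal subgroups `A ≤ B` of `G`, with `G` acting by conjugation: the section `B / A` is the
natural module, where `g : G` acts on the natural module through the matrix `π g`. The isomorphism
`B / A ≃ NatMod` is given as a surjective equivariant homomorphism from `B` with kernel `A`. -/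
def IsNaturalSection (π : G →* L22) (A B : Subgroup G) : Prop :=
  ∃ f : B →* Multiplicative NatMod,
    Function.Surjective f ∧
    (∀ b : B, f b = 1 ↔ (b : G) ∈ A) ∧
    ∀ (g : G) (b c : B), (c : G) = g * (b : G) * g⁻¹ →
      (f c).toAdd = Matrix.mulVec (π g : Matrix (Fin 2) (Fin 2) (ZMod 2)) (f b).toAdd

/-- For normal subgroups of `G`: the section `B / A` is an irreducible module for `G`, that is,
`A < B` and no normal subgroup of `G` lies strictly between. (Submodules of `B / A` correspond to
the normal subgroups of `G` between `A` and `B`.) -/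
def IsIrreducibleSection (A B : Subgroup G) : Prop :=
  A < B ∧ ∀ N : Subgroup G, N.Normal → A ≤ N → N ≤ B → N = A ∨ N = B

/-- `G` is a biextraspecial group of rank `m` with `Q` as its normal 2-subgroup. -/
structure IsBiextraspecialWith (Q : Subgroup G) [Q.Normal] (m : ℕ) : Prop where
  /-- `Q` has order `2 ^ (2 + 2m)`. -/
  card_eq : Nat.card Q = 2 ^ (2 + 2 * m)
  /-- `Q / Z` is elementary abelian. -/
  comm_mem : ∀ x ∈ Q, ∀ y ∈ Q, x * y * x⁻¹ * y⁻¹ ∈ Z Q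
  sq_mem : ∀ x ∈ Q, x ^ 2 ∈ Z Q
  /-- `G / Q` is isomorphic to `L = L₂(2)`; as `L`-modules, `Z` is the natural module, and every
  composition factor (irreducible section) of `Q / Z` is the natural module. -/
  exists_proj : ∃ π : G →* L22, Function.Surjective π ∧ π.ker = Q ∧
    IsNaturalSection π ⊥ (Z Q) ∧
    ∀ A B : Subgroup G, A.Normal → B.Normal → Z Q ≤ A → B ≤ Q → IsIrreducibleSection A B →
      IsNaturalSection π A B

/-- A dent: a normal subgroup `D` of `G` with `Z < D < Q` such that `D / Z` is irreducible. -/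
structure IsDent (Q D : Subgroup G) : Prop where
  normal : D.Normal
  irreducible : IsIrreducibleSection (Z Q) D
  lt : D < Q

/-- The dents together with a formal zero. -/
abbrev DentSpace (Q : Subgroup G) : Type _ := WithZero {D : Subgroup G // IsDent Q D}

/-- The image `D / Z` of `D` in `G / Z`. -/
abbrev bar (Q : Subgroup G) [Q.Normal] (D : Subgroup G) : Subgroup (G ⧸ Z Q) :=
  D.map (QuotientGroup.mk' (Z Q))

/-- `D₃` is the full preimage of the diagonal `{x φ(x) | x ∈ D₁ / Z}`, where `φ` is an isomorphism
from `D₁ / Z` to `D₂ / Z` commuting with conjugation by elements of `G`. -/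
def IsDiagonal (Q : Subgroup G) [Q.Normal] (D₁ D₂ D₃ : Subgroup G) : Prop :=
  ∃ φ : bar Q D₁ ≃* bar Q D₂,
    (∀ (g : G) (x y : bar Q D₁),
      (y : G ⧸ Z Q) = (g : G ⧸ Z Q) * (x : G ⧸ Z Q) * (g : G ⧸ Z Q)⁻¹ →
        (φ y : G ⧸ Z Q) = (g : G ⧸ Z Q) * (φ x : G ⧸ Z Q) * (g : G ⧸ Z Q)⁻¹) ∧
    ∀ d : G, d ∈ D₃ ↔ ∃ x : bar Q D₁, (d : G ⧸ Z Q) = (x : G ⧸ Z Q) * (φ x : G ⧸ Z Q)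

/-- The graph of the addition of the dent space: `IsSum Q X Y W` says `X + Y = W`. The formal zero
is neutral, `D + D = 0`, and for distinct dents `D₁ + D₂` is the diagonal dent. -/
def IsSum (Q : Subgroup G) [Q.Normal] : DentSpace Q → DentSpace Q → DentSpace Q → Prop
  | none, Y, W => W = Y
  | X, none, W => W = X
  | some D₁, some D₂, none => D₁ = D₂
  | some D₁, some D₂, some D₃ => D₁ ≠ D₂ ∧ IsDiagonal Q D₁.1 D₂.1 D₃.1

/-- A subgroup is singular if it is isomorphic to `2^4`. -/
def IsSingular (D : Subgroup G) : Prop := Nonempty (D ≃* Multiplicative (Fin 4 → ZMod 2))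

open Classical in
/-- The quadratic form of the dent space: `0` at the formal zero and at singular dents, `1` at
non-singular dents. -/
noncomputable def dentForm (Q : Subgroup G) : DentSpace Q → ZMod 2
  | none => 0
  | some D => if IsSingular D.1 then 0 else 1

/-- The dent space with its addition and its quadratic form is isometric to `(V, q)`. -/
def DentSpaceIsometric (Q : Subgroup G) [Q.Normal] {V : Type} [AddCommGroup V] [Module (ZMod 2) V]
    (q : QuadraticForm (ZMod 2) V) : Prop :=
  ∃ e : V ≃ DentSpace Q,
    (∀ u v : V, IsSum Q (e u) (e v) (e (u + v))) ∧ ∀ v : V, dentForm Q (e v) = q v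

end Structure

/-- The two types `+` and `-` of nondegenerate quadratic forms over `GF(2)` in even dimension. -/
inductive FormType
  | plus
  | minus

abbrev Plane : Type := ZMod 2 × ZMod 2

/-- The hyperbolic plane: the form `x y`. -/
def hyperbolicPlane : QuadraticForm (ZMod 2) Plane :=
  QuadraticMap.linMulLin (LinearMap.fst (ZMod 2) (ZMod 2) (ZMod 2))
    (LinearMap.snd (ZMod 2) (ZMod 2) (ZMod 2))

/-- The anisotropic plane: the form `x ^ 2 + x y + y ^ 2`. -/
def anisotropicPlane : QuadraticForm (ZMod 2) Plane :=
  QuadraticMap.linMulLin (LinearMap.fst (ZMod 2) (ZMod 2) (ZMod 2))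
      (LinearMap.fst (ZMod 2) (ZMod 2) (ZMod 2)) +
    hyperbolicPlane +
    QuadraticMap.linMulLin (LinearMap.snd (ZMod 2) (ZMod 2) (ZMod 2))
      (LinearMap.snd (ZMod 2) (ZMod 2) (ZMod 2))

/-- The orthogonal sum of `k` hyperbolic planes. -/
def hyperbolicSum (k : ℕ) : QuadraticForm (ZMod 2) (Fin k → Plane) :=
  QuadraticMap.pi fun _ => hyperbolicPlane

/-- The type of the quadratic form of the dent space: type `+` means an orthogonal sum of hyperbolic
planes, type `-` an orthogonal sum of hyperbolic planes and one anisotropic plane. -/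
def HasType {G : Type*} [Group G] (Q : Subgroup G) [Q.Normal] : FormType → Prop
  | .plus => ∃ k : ℕ, DentSpaceIsometric Q (hyperbolicSum k)
  | .minus => ∃ k : ℕ, DentSpaceIsometric Q ((hyperbolicSum k).prod anisotropicPlane)

/-- `G` is a biextraspecial group of rank `m` and type `ε`. -/
def IsBiextraspecial (G : Type*) [Group G] (m : ℕ) (ε : FormType) : Prop :=
  ∃ (Q : Subgroup G) (_ : Q.Normal), IsBiextraspecialWith Q m ∧ HasType Q ε

end Biextraspecial

/-! Write N for the natural module and L for L₂(2). Any lift of an element of order three acts on Q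
without nontrivial fixed points: on Q/Z because all its irreducible sections are natural
(`mem_Z_of_rot_fixed`), on Z because Z itself is N. Hence G splits over Q (`exists_section`), and
Q/Z is N ⊗ U with L trivial on U (`exists_equiv_of_rot_sum`). Squaring in Q induces an equivariant
map N ⊗ U → N with biadditive polar map, and every such map comes from a quadratic form q on U
(`exists_eq_sqMap`). A `Framing` records these data.

In such coordinates the dents are the preimages of N ⊗ ⟨u⟩ for u ≠ 0. An element over v ⊗ u has
square q(u)v, so the dent is 2^4 exactly when q(u) = 0, and the dent space is (U, q)
(`exists_dentSpace_equiv`).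

For uniqueness, choose a bilinear β with β(u,u) = q(u). Together with a commutative equivariant
product on N it gives an equivariant cocycle on N ⊗ U. Twisting the multiplication of Q by this
cocycle kills all squares, so Q becomes an L-module over GF(2), again a multiple of N, and its
projection to N ⊗ U splits. Read in Q, the splitting is an equivariant section with known
multiplication (`exists_lift`), so G is `Model β` extended by L. This group depends on β alone.

For existence the same model is used; nondegeneracy of q makes the centre no larger than N
(`modelFraming`). Finally the rank fixes the number of planes, so rank and type determine the form.
-/

namespace Biextraspecial

/-! ### The group L₂(2) and its generators -/

/-- The transvection fixing the first standard basis vector. -/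
def tau : L22 := ⟨!![1, 1; 0, 1], by decide⟩

/-- An element of order three. -/
def rot : L22 := ⟨!![0, 1; 1, 1], by decide⟩

theorem L22_eq (A : L22) : A = 1 ∨ A = tau ∨ A = rot ∨ A = rot * tau ∨ A = rot * rot ∨
    A = rot * (rot * tau) := by
  revert A; decide

theorem rot_cube : rot * rot * rot = 1 := by decide

theorem tau_mul_tau : tau * tau = 1 := by decide

theorem tau_mul_rot : tau * rot = rot * rot * tau := by decide

theorem conj_rot (A : L22) : A * rot * A⁻¹ = rot ∨ A * rot * A⁻¹ = rot⁻¹ := by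
  revert A; decide

theorem rot_ne_inv : rot ≠ rot⁻¹ := by decide

/-- Since `tau` and `rot` generate, equivariance need only be checked on these two. -/
theorem L22_induction {P : L22 → Prop} (one : P 1) (tau_mul : ∀ A, P A → P (tau * A))
    (rot_mul : ∀ A, P A → P (rot * A)) (A : L22) : P A := by
  have ht : P tau := by simpa using tau_mul 1 one
  rcases L22_eq A with rfl | rfl | rfl | rfl | rfl | rfl
  · exact one
  · exact ht
  · simpa using rot_mul 1 one
  · exact rot_mul _ ht
  · exact rot_mul _ (by simpa using rot_mul 1 one)
  · exact rot_mul _ (rot_mul _ ht)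

theorem zmod_two_cases (a : ZMod 2) : a = 0 ∨ a = 1 := by
  revert a; decide

/-! ### Multiples of the natural module and equivariant squaring maps -/

section Module

variable {U : Type*} [AddCommGroup U] [Module (ZMod 2) U]

theorem add_self_eq_zero' (u : U) : u + u = 0 := by
  have h : (1 + 1 : ZMod 2) • u = 0 := by
    rw [show (1 + 1 : ZMod 2) = 0 by decide, zero_smul]
  simpa [add_smul] using h

theorem eq_of_add_eq_zero' {u v : U} (h : u + v = 0) : u = v := by
  rw [eq_neg_of_add_eq_zero_left h, eq_comm]
  exact eq_neg_of_add_eq_zero_left (add_self_eq_zero' v)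

theorem neg_eq_self' (u : U) : -u = u := (eq_of_add_eq_zero' (neg_add_cancel u))

theorem add_add_self' (u v : U) : u + (u + v) = v := by
  rw [← add_assoc, add_self_eq_zero', zero_add]

/-- The action of `L₂(2)` on the tensor product of the natural module with `U`. -/
def act (A : L22) (w : Fin 2 → U) : Fin 2 → U := fun i => A i 0 • w 0 + A i 1 • w 1

theorem act_eq_mulVec (A : L22) (v : NatMod) :
    act A v = Matrix.mulVec (A : Matrix (Fin 2) (Fin 2) (ZMod 2)) v := by
  ext i
  simp [act, Matrix.mulVec, dotProduct, Fin.sum_univ_two]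

theorem act_one (w : Fin 2 → U) : act 1 w = w := by
  ext i; fin_cases i <;> simp [act]

theorem act_mul (A B : L22) (w : Fin 2 → U) : act (A * B) w = act A (act B w) := by
  ext i
  simp only [act, Matrix.SpecialLinearGroup.coe_mul, Matrix.mul_apply, Fin.sum_univ_two]
  module

theorem act_add (A : L22) (w w' : Fin 2 → U) : act A (w + w') = act A w + act A w' := by
  ext i
  simp only [act, Pi.add_apply]
  module

theorem act_zero (A : L22) : act A (0 : Fin 2 → U) = 0 := by
  ext i; simp [act]

theorem act_tau (w : Fin 2 → U) : act tau w = ![w 0 + w 1, w 1] := by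
  ext i; fin_cases i <;> simp [act, tau]

theorem act_rot (w : Fin 2 → U) : act rot w = ![w 1, w 0 + w 1] := by
  ext i; fin_cases i <;> simp [act, rot]

theorem act_rot_rot_tau (w : Fin 2 → U) : act (rot * (rot * tau)) w = ![w 0, w 0 + w 1] := by
  rw [act_mul, act_mul, act_tau, act_rot, act_rot]
  ext i; fin_cases i
  · have := add_add_self' (w 1) (w 0)
    simpa [add_comm, add_left_comm] using this
  · have := add_add_self' (w 1) (w 0 + w 1)
    simpa [add_comm, add_left_comm] using this

theorem eq_zero_of_act_rot {w : Fin 2 → U} (h : act rot w = w) : w = 0 := by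
  rw [act_rot] at h
  have h0 : w 1 = w 0 := congrFun h 0
  have h1 : w 0 + w 1 = w 1 := congrFun h 1
  have h2 : w 0 = 0 := by simpa using h1
  ext i; fin_cases i
  · exact h2
  · exact h0.trans h2

theorem exists_act_eq {v v' : NatMod} (hv : v ≠ 0) (hv' : v' ≠ 0) : ∃ A : L22, act A v = v' := by
  have key : ∀ v v' : NatMod, v ≠ 0 → v' ≠ 0 → ∃ A : L22,
      (fun i => A i 0 * v 0 + A i 1 * v 1) = v' := by decide
  obtain ⟨A, hA⟩ := key v v' hv hv'
  exact ⟨A, hA⟩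

/-- An additive map `j` to the fixed points of `tau` in a module without fixed points of `rot`
extends to an equivariant map on `Fin 2 → U`. -/
theorem equivariant_extend {M : Type*} [AddCommGroup M] [Module (ZMod 2) M]
    (ρ : L22 →* Module.End (ZMod 2) M) (hρ : ∀ x, x + ρ rot x + ρ rot (ρ rot x) = 0)
    (j : U →ₗ[ZMod 2] M) (hj : ∀ u, ρ tau (j u) = j u) (A : L22) (w : Fin 2 → U) :
    j (act A w 0) + ρ rot (j (act A w 1)) = ρ A (j (w 0) + ρ rot (j (w 1))) := by
  have hsq (x : M) : ρ rot (ρ rot x) = x + ρ rot x := (eq_of_add_eq_zero' (hρ x)).symm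
  induction A using L22_induction with
  | one => simp [act_one]
  | tau_mul A ih =>
    rw [act_mul, map_mul, Module.End.mul_apply, ← ih, act_tau]
    simp only [Matrix.cons_val_zero, Matrix.cons_val_one, Matrix.cons_val_fin_one, map_add]
    rw [hj, ← Module.End.mul_apply, ← map_mul, tau_mul_rot, map_mul, map_mul,
      Module.End.mul_apply, Module.End.mul_apply, hj, hsq]
    abel
  | rot_mul A ih =>
    rw [act_mul, map_mul, Module.End.mul_apply, ← ih, act_rot]
    simp only [Matrix.cons_val_zero, Matrix.cons_val_one, Matrix.cons_val_fin_one, map_add]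
    rw [hsq]
    abel

/-- A module on which `1 + rot + rot ^ 2` vanishes is a multiple of the natural module. -/
theorem exists_equiv_of_rot_sum {M : Type*} [AddCommGroup M] [Module (ZMod 2) M]
    (ρ : L22 →* Module.End (ZMod 2) M) (hρ : ∀ x, x + ρ rot x + ρ rot (ρ rot x) = 0) :
    ∃ (U : Submodule (ZMod 2) M) (e : M ≃+ (Fin 2 → U)), ∀ A x, e (ρ A x) = act A (e x) := by
  have hsq (x : M) : ρ rot (ρ rot x) = x + ρ rot x := (eq_of_add_eq_zero' (hρ x)).symm
  have hcube (x : M) : ρ rot (ρ rot (ρ rot x)) = x := by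
    rw [← Module.End.mul_apply, ← map_mul, ← Module.End.mul_apply, ← map_mul,
      rot_cube, map_one, Module.End.one_apply]
  have htt (x : M) : ρ tau (ρ tau x) = x := by
    rw [← Module.End.mul_apply, ← map_mul, tau_mul_tau, map_one, Module.End.one_apply]
  have htr (x : M) : ρ tau (ρ rot x) = ρ rot (ρ rot (ρ tau x)) := by
    rw [← Module.End.mul_apply, ← map_mul, tau_mul_rot, map_mul, map_mul]; rfl
  -- In the natural module `tau` fixes only the multiples of the first basis vector, and `rot`
  -- carries that vector to the second. So the fixed points of `tau` serve as coefficient space.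
  let U : Submodule (ZMod 2) M := LinearMap.ker (ρ tau - LinearMap.id)
  have hU (x : M) : x ∈ U ↔ ρ tau x = x := by simp [U, sub_eq_zero]
  let f : (Fin 2 → U) →+ M :=
    { toFun := fun w => (w 0 : M) + ρ rot (w 1 : M)
      map_zero' := by simp
      map_add' := fun w w' => by simp only [Pi.add_apply, Submodule.coe_add, map_add]; abel }
  have hf (w : Fin 2 → U) : f w = (w 0 : M) + ρ rot (w 1 : M) := rfl
  have hfA (A : L22) (w : Fin 2 → U) : f (act A w) = ρ A (f w) :=
    equivariant_extend ρ hρ U.subtype (fun u => (hU _).1 u.2) A w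
  have hinj : Function.Injective f := by
    refine (injective_iff_map_eq_zero f).2 fun w h => ?_
    rw [hf] at h
    have h0 := (hU _).1 (w 0).2
    have h1 := (hU _).1 (w 1).2
    have h' : (w 0 : M) + ρ rot (ρ rot (w 1 : M)) = 0 := by
      have := congrArg (ρ tau) h
      rwa [map_add, htr, h0, h1, map_zero] at this
    have h'' : (w 1 : M) = 0 := by
      rw [hsq, eq_of_add_eq_zero' h, add_comm, add_assoc, add_self_eq_zero', add_zero] at h'
      exact h'
    rw [h'', map_zero, add_zero] at h
    ext i; fin_cases i
    · exact h
    · exact h''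
  have hsurj : Function.Surjective f := by
    intro x
    have hN (y : M) : y + ρ tau y ∈ U := by
      rw [hU, map_add, htt, add_comm]
    -- The witness is x = (1 + tau) rot² x + rot (1 + tau) x: as tau rot² = rot tau, the terms in
    -- tau cancel and rot² x + rot x = x remains.
    refine ⟨![⟨_, hN (ρ rot (ρ rot x))⟩, ⟨_, hN x⟩], ?_⟩
    rw [hf]
    simp only [Matrix.cons_val_zero, Matrix.cons_val_one, Matrix.cons_val_fin_one, map_add]
    rw [htr, htr, hcube, hsq x]
    have e1 := add_self_eq_zero' (ρ rot x)
    have e2 := add_self_eq_zero' (ρ rot (ρ tau x))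
    calc _ = x + (ρ rot x + ρ rot x) + (ρ rot (ρ tau x) + ρ rot (ρ tau x)) := by abel
      _ = x := by rw [e1, e2, add_zero, add_zero]
  let e : M ≃+ (Fin 2 → U) := (AddEquiv.ofBijective f ⟨hinj, hsurj⟩).symm
  have hef (w) : e (f w) = w := (AddEquiv.ofBijective f ⟨hinj, hsurj⟩).symm_apply_apply w
  have hfe (x) : f (e x) = x := (AddEquiv.ofBijective f ⟨hinj, hsurj⟩).apply_symm_apply x
  refine ⟨U, e, fun A x => ?_⟩
  apply hinj
  rw [hfe, hfA, hfe]

/-- The squaring map attached to a quadratic form. -/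
def sqMap (q : QuadraticForm (ZMod 2) U) (w : Fin 2 → U) : NatMod :=
  fun i => q (w i) + QuadraticMap.polar q (w 0) (w 1)

theorem polar_self' (q : QuadraticForm (ZMod 2) U) (u : U) : QuadraticMap.polar q u u = 0 := by
  rw [QuadraticMap.polar, add_self_eq_zero', map_zero]
  have := add_self_eq_zero' (q u)
  rw [zero_sub, ← neg_add', this, neg_zero]

/-- The pure tensor. -/
def tens (v : NatMod) (u : U) : Fin 2 → U := fun i => v i • u

theorem tens_add (v v' : NatMod) (u : U) : tens (v + v') u = tens v u + tens v' u := by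
  ext i; simp [tens, add_smul]

theorem act_tens (A : L22) (v : NatMod) (u : U) : act A (tens v u) = tens (act A v) u := by
  ext i
  simp only [act, tens, smul_eq_mul]
  module

theorem tens_eq_zero_iff {v : NatMod} {u : U} (hu : u ≠ 0) : tens v u = 0 ↔ v = 0 := by
  refine ⟨fun h => ?_, fun h => by ext i; simp [tens, h]⟩
  ext i
  have := congrFun h i
  rcases zmod_two_cases (v i) with h | h
  · exact h
  · simp [tens, h, hu] at this

theorem sqMap_tens (q : QuadraticForm (ZMod 2) U) (v : NatMod) (u : U) :
    sqMap q (tens v u) = fun i => v i * q u := by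
  ext i
  simp only [sqMap, tens, QuadraticMap.map_smul, QuadraticMap.polar_smul_left,
    QuadraticMap.polar_smul_right, polar_self', smul_eq_mul]
  rcases zmod_two_cases (v i) with h | h <;> simp [h]

/-- An equivariant map with biadditive polar map comes from a quadratic form. -/
theorem exists_eq_sqMap (s : (Fin 2 → U) → NatMod) (hs : ∀ A w, s (act A w) = act A (s w))
    (h0 : s 0 = 0)
    (hadd : ∀ w₁ w₂ w₃, s (w₁ + w₂ + w₃) + s (w₁ + w₂) + s (w₁ + w₃) + s (w₂ + w₃) +
      s w₁ + s w₂ + s w₃ = 0) :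
    ∃ q : QuadraticForm (ZMod 2) U, s = sqMap q := by
  have hC (w₁ w₂ w₃ : Fin 2 → U) : s (w₁ + (w₂ + w₃)) =
      s (w₁ + w₂) + s (w₁ + w₃) + s (w₂ + w₃) + s w₁ + s w₂ + s w₃ := by
    rw [← add_assoc]
    apply eq_of_add_eq_zero'
    rw [← hadd w₁ w₂ w₃]
    abel
  -- The vector (u, 0) is fixed by `tau`, hence so is its value, whose second coordinate must
  -- vanish.
  have h10 (u : U) : s ![u, 0] 1 = 0 := by
    have h := hs tau ![u, 0]
    rw [act_tau, act_tau] at h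
    have := congrFun h 0
    simpa using this
  have hrot (u : U) : s ![0, u] = ![0, s ![u, 0] 0] := by
    have h := hs rot ![u, 0]
    rw [act_rot, act_rot, h10] at h
    simpa using h
  -- Each of two transvections sends (u, u') to a sum of three vectors, where `s` can be computed
  -- both by equivariance and by the vanishing third difference. Comparing the results, `tau`
  -- determines coordinate 1 of the value at (u, u') and the other transvection determines
  -- coordinate 0.
  have hpol (u u' : U) : s ![u, u'] =
      fun i => s ![![u, u'] i, 0] 0 + (s ![u + u', 0] 0 + s ![u, 0] 0 + s ![u', 0] 0) := by
    have e1 := hs tau ![u, u']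
    have e2 := hs (rot * (rot * tau)) ![u, u']
    rw [act_tau, act_tau] at e1
    rw [act_rot_rot_tau, act_rot_rot_tau] at e2
    have hdiag (u : U) : s ![u, u] = ![s ![u, 0] 0, s ![u, 0] 0] := by
      have h := hs rot ![0, u]
      rw [act_rot, act_rot, hrot] at h
      simpa using h
    have f1 := congrFun (hC ![u, 0] ![u', 0] ![0, u']) 0
    have f2 := congrFun (hC ![0, u'] ![u, 0] ![0, u]) 1
    have g1 := congrFun e1 0
    have g2 := congrFun e2 1
    simp only [Matrix.cons_add_cons, add_zero, zero_add, Matrix.empty_add_empty, Pi.add_apply,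
      hdiag, hrot, h10, Matrix.cons_val_zero, Matrix.cons_val_one, Matrix.cons_val_fin_one]
      at f1 f2 g1 g2
    rw [f1] at g1
    rw [add_comm u u'] at g2 g1
    rw [f2] at g2
    rw [add_comm u u']
    ext i
    fin_cases i
    · simp only [Fin.zero_eta, Matrix.cons_val_zero]
      generalize s ![u, u'] 0 = a at *
      generalize s ![u, u'] 1 = b at *
      generalize s ![u' + u, 0] 0 = c at *
      generalize s ![u, 0] 0 = d at *
      generalize s ![u', 0] 0 = e at *
      clear * - g2
      revert a b c d e; decide
    · simp only [Fin.mk_one, Matrix.cons_val_one, Matrix.cons_val_fin_one]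
      generalize s ![u, u'] 0 = a at *
      generalize s ![u, u'] 1 = b at *
      generalize s ![u' + u, 0] 0 = c at *
      generalize s ![u, 0] 0 = d at *
      generalize s ![u', 0] 0 = e at *
      clear * - g1
      revert a b c d e; decide
  let q : QuadraticForm (ZMod 2) U := QuadraticMap.ofPolar (fun u => s ![u, 0] 0)
    (by
      intro a u
      rcases zmod_two_cases a with rfl | rfl
      · have : (![0, 0] : Fin 2 → U) = 0 := by ext i; fin_cases i <;> rfl
        simp [this, h0]
      · simp)
    (by
      intro u u' u''
      have h := congrFun (hC ![u, 0] ![u', 0] ![u'', 0]) 0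
      simp only [Matrix.cons_add_cons, add_zero, Matrix.empty_add_empty, Pi.add_apply] at h
      simp only [QuadraticMap.polar, sub_eq_add_neg, neg_eq_self', add_assoc, h]
      generalize s ![u, 0] 0 = a
      generalize s ![u', 0] 0 = b
      generalize s ![u'', 0] 0 = c
      generalize s ![u + u', 0] 0 = d
      generalize s ![u + u'', 0] 0 = e
      generalize s ![u' + u'', 0] 0 = f
      clear * -
      revert a b c d e f; decide)
    (by
      intro a u u'
      rcases zmod_two_cases a with rfl | rfl
      · have : (![0, 0] : Fin 2 → U) = 0 := by ext i; fin_cases i <;> rfl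
        simp [QuadraticMap.polar, this, h0]
      · simp)
  refine ⟨q, ?_⟩
  funext w
  have hw : w = ![w 0, w 1] := by ext i; fin_cases i <;> rfl
  rw [hw, hpol]
  ext i
  simp only [sqMap, QuadraticMap.polar, sub_eq_add_neg, neg_eq_self']
  rfl

end Module
-- Fixed-point-free lifts and splitting
section
variable {G : Type*} [Group G]

/-- The map y ↦ y g y⁻¹ g⁻¹ on the kernel is injective because `g` has no fixed points there, hence
surjective by finiteness. -/
theorem exists_conj_eq_of_fixed_free (π : G →* L22) [Finite π.ker] {g : G}
    (hfix : ∀ x, π x = 1 → g * x * g⁻¹ = x → x = 1) {g' : G} (hg' : π g' = π g) :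
    ∃ y, π y = 1 ∧ y * g * y⁻¹ = g' := by
  let φ : π.ker → π.ker := fun y => ⟨y * g * (y : G)⁻¹ * g⁻¹, by
    have := y.2
    rw [MonoidHom.mem_ker] at this ⊢
    simp [this]⟩
  have hφ : Function.Injective φ := by
    intro y y' h
    have h1 : (y : G) * g * (y : G)⁻¹ * g⁻¹ = y' * g * (y' : G)⁻¹ * g⁻¹ := congrArg Subtype.val h
    have h2 : (y : G) * g * (y : G)⁻¹ = y' * g * (y' : G)⁻¹ := mul_right_cancel h1
    have h3 := hfix ((y' : G)⁻¹ * y) (by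
      rw [map_mul, map_inv, MonoidHom.mem_ker.1 y.2, MonoidHom.mem_ker.1 y'.2]; simp) (by
      have h4 : (y' : G) * g = (y * g * (y : G)⁻¹) * y' := by rw [h2]; group
      have h5 : g = (y' : G)⁻¹ * ((y * g * (y : G)⁻¹) * y') := by rw [← h4]; group
      calc g * ((y' : G)⁻¹ * y) * g⁻¹
          = (y' : G)⁻¹ * ((y * g * (y : G)⁻¹) * y') * ((y' : G)⁻¹ * y) * g⁻¹ := by rw [← h5]
        _ = (y' : G)⁻¹ * y := by group)
    exact Subtype.ext (inv_mul_eq_one.1 h3).symm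
  obtain ⟨y, hy⟩ := Finite.surjective_of_injective hφ ⟨g' * g⁻¹, by simp [MonoidHom.mem_ker, hg']⟩
  refine ⟨y, y.2, ?_⟩
  have : (y : G) * g * (y : G)⁻¹ * g⁻¹ = g' * g⁻¹ := congrArg Subtype.val hy
  exact mul_right_cancel this

/-- If elements over `rot` act without fixed points on a finite kernel, the projection splits. -/
theorem exists_section (π : G →* L22) (hπ : Function.Surjective π) [Finite π.ker]
    (hfix : ∀ g, π g = rot → ∀ x, π x = 1 → g * x * g⁻¹ = x → x = 1) :
    ∃ σ : L22 →* G, ∀ A, π (σ A) = A := by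
  obtain ⟨g, hg⟩ := hπ rot
  -- The complement is the group of elements centralizing or inverting one lift `g` of `rot`. It
  -- meets the kernel trivially, since a kernel element cannot invert `g` (`rot` is not its own
  -- inverse). It covers L₂(2) because a conjugate of `g` or its inverse lies over `rot`, and can be
  -- moved back to `g` by the kernel.
  let N : Subgroup G :=
    { carrier := {x | x * g * x⁻¹ = g ∨ x * g * x⁻¹ = g⁻¹}
      one_mem' := by simp
      mul_mem' := by
        intro a b ha hb
        have e : a * b * g * (a * b)⁻¹ = a * (b * g * b⁻¹) * a⁻¹ := by group
        have e' : a * g⁻¹ * a⁻¹ = (a * g * a⁻¹)⁻¹ := by group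
        simp only [Set.mem_ofPred_eq] at *
        rw [e]
        rcases hb with hb | hb <;> rw [hb]
        · exact ha
        · rw [e']
          rcases ha with ha | ha <;> simp [ha]
      inv_mem' := by
        intro a ha
        simp only [Set.mem_ofPred_eq] at *
        rcases ha with ha | ha
        · left
          nth_rw 1 [← ha]; group
        · right
          have : g = (a * g * a⁻¹)⁻¹ := by rw [ha, inv_inv]
          nth_rw 1 [this]; group }
  have hN (x : G) : x ∈ N ↔ x * g * x⁻¹ = g ∨ x * g * x⁻¹ = g⁻¹ := Iff.rfl
  have hbij : Function.Bijective (π.comp N.subtype) := by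
    constructor
    · refine (injective_iff_map_eq_one _).2 fun x hx => ?_
      have hx' : π x = 1 := hx
      rcases (hN x).1 x.2 with h | h
      · apply Subtype.ext
        refine hfix g hg x hx' ?_
        have : (x : G) * g = g * x := by
          nth_rw 2 [← h]; group
        rw [← this]; group
      · have := congrArg π h
        simp only [map_mul, map_inv, hx', hg, one_mul, inv_one, mul_one] at this
        exact absurd this rot_ne_inv
    · intro A
      obtain ⟨x, rfl⟩ := hπ A
      rcases conj_rot (π x) with h | h
      · obtain ⟨y, hy, e⟩ := exists_conj_eq_of_fixed_free π (hfix g hg) (g' := x * g * x⁻¹)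
          (by simp [hg, h])
        refine ⟨⟨y⁻¹ * x, Or.inl ?_⟩, by simp [hy]⟩
        calc y⁻¹ * x * g * (y⁻¹ * x)⁻¹ = y⁻¹ * (x * g * x⁻¹) * y := by group
          _ = g := by rw [← e]; group
      · obtain ⟨y, hy, e⟩ := exists_conj_eq_of_fixed_free π (hfix g hg) (g' := (x * g * x⁻¹)⁻¹)
          (by rw [map_inv, map_mul, map_mul, map_inv, hg, h, inv_inv])
        refine ⟨⟨y⁻¹ * x, Or.inr ?_⟩, by simp [hy]⟩
        calc y⁻¹ * x * g * (y⁻¹ * x)⁻¹ = (y⁻¹ * (x * g * x⁻¹)⁻¹ * y)⁻¹ := by group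
          _ = g⁻¹ := by rw [← e]; group
  let e := MulEquiv.ofBijective _ hbij
  exact ⟨N.subtype.comp e.symm.toMonoidHom, fun A => e.apply_symm_apply A⟩

theorem Z_le (Q : Subgroup G) : Z Q ≤ Q := by
  rintro _ ⟨x, -, rfl⟩
  exact x.2

theorem coe_mem_Z_iff {Q : Subgroup G} (x : Q) : (x : G) ∈ Z Q ↔ x ∈ Subgroup.center Q :=
  ⟨fun ⟨y, hy, e⟩ => by
    have : y = x := Subtype.ext e
    exact this ▸ hy, fun h => ⟨x, h, rfl⟩⟩

/-- Elements over `rot` have no fixed points on `Q / Z` if all chief factors are natural. -/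
theorem mem_Z_of_rot_fixed [Finite G] {Q : Subgroup G} [Q.Normal] {π : G →* L22}
    (hsec : ∀ A B : Subgroup G, A.Normal → B.Normal → Z Q ≤ A → B ≤ Q → IsIrreducibleSection A B →
      IsNaturalSection π A B) {g : G} (hg : π g = rot) {x : G} (hxQ : x ∈ Q)
    (hx : g * x * g⁻¹ * x⁻¹ ∈ Z Q) : x ∈ Z Q := by
  by_contra hxZ
  -- Maximality of `A` among the normal subgroups avoiding `x` makes the section up to the normal
  -- closure of `A` and `x` irreducible, hence natural. The image of `x` there is a nonzero vector
  -- fixed by `rot`, which is impossible.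
  obtain ⟨A, hA⟩ := (Set.toFinite {N : Subgroup G | N.Normal ∧ Z Q ≤ N ∧ N ≤ Q ∧ x ∉ N}).exists_maximal
    ⟨Z Q, inferInstance, le_rfl, Z_le Q, hxZ⟩
  obtain ⟨⟨hAn, hZA, hAQ, hxA⟩, hmax⟩ := hA
  let B := Subgroup.normalClosure ((A : Set G) ∪ {x})
  have hAB : A ≤ B := fun a ha => Subgroup.subset_normalClosure (Or.inl ha)
  have hxB : x ∈ B := Subgroup.subset_normalClosure (Or.inr rfl)
  have hBle (N : Subgroup G) (hN : N.Normal) (h : A ≤ N) (hx : x ∈ N) : B ≤ N := by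
    apply Subgroup.normalClosure_le_normal
    rintro y (hy | rfl)
    · exact h hy
    · exact hx
  have hBQ : B ≤ Q := hBle Q inferInstance hAQ hxQ
  obtain ⟨f, -, hker, heq⟩ := hsec A B hAn Subgroup.normalClosure_normal hZA hBQ
    ⟨lt_of_le_of_ne hAB (fun h => hxA (h ▸ hxB)), fun N hN h1 h2 => by
      by_cases hxN : x ∈ N
      · exact Or.inr (le_antisymm h2 (hBle N hN h1 hxN))
      · exact Or.inl (le_antisymm (hmax ⟨hN, hZA.trans h1, h2.trans hBQ, hxN⟩ h1) h1)⟩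
  let b : B := ⟨x, hxB⟩
  let c : B := ⟨g * x * g⁻¹, Subgroup.normalClosure_normal.conj_mem x hxB g⟩
  have h1 := heq g b c rfl
  have h2 : f (c * b⁻¹) = 1 := (hker _).2 (hZA hx)
  rw [map_mul, map_inv, mul_inv_eq_one] at h2
  rw [h2, ← act_eq_mulVec, hg] at h1
  have h3 : (f b).toAdd = 0 := eq_zero_of_act_rot h1.symm
  exact hxA ((hker b).1 h3)

end

/-! ### Framings and their existence -/

/-- Coordinates on a group with normal subgroup `Q`: an equivariant isomorphism of `Q / Z` with
the tensor product of the natural module and `U`, for which the squaring map comes from `q`. -/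
structure Framing {G : Type*} [Group G] (Q : Subgroup G) {U : Type*} [AddCommGroup U]
    [Module (ZMod 2) U] (q : QuadraticForm (ZMod 2) U) where
  proj : G →* L22
  proj_surj : Function.Surjective proj
  ker_proj : proj.ker = Q
  coord : Q →* Multiplicative (Fin 2 → U)
  coord_surj : Function.Surjective coord
  coord_conj : ∀ (g : G) (x y : Q), (y : G) = g * x * g⁻¹ →
    (coord y).toAdd = act (proj g) (coord x).toAdd
  coord_eq_one_iff : ∀ x : Q, coord x = 1 ↔ (x : G) ∈ Z Q
  cen : Multiplicative NatMod →* Q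
  cen_inj : Function.Injective cen
  cen_conj : ∀ (g : G) (v : NatMod), (cen (.ofAdd (act (proj g) v)) : G) =
    g * cen (.ofAdd v) * g⁻¹
  range_cen : ∀ x : Q, (x : G) ∈ Z Q ↔ ∃ v, cen (.ofAdd v) = x
  mul_self : ∀ x, x * x = cen (.ofAdd (sqMap q (coord x).toAdd))

universe u

theorem IsBiextraspecialWith.finite {G : Type*} [Group G] {Q : Subgroup G} [Q.Normal] {m : ℕ}
    (h : IsBiextraspecialWith Q m) : Finite G := by
  obtain ⟨π, hsurj, hker, -⟩ := h.exists_proj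
  rw [finite_iff_subgroup_quotient Q]
  refine ⟨Nat.finite_of_card_ne_zero (by rw [h.card_eq]; positivity), ?_⟩
  subst hker
  exact Finite.of_equiv _ (QuotientGroup.quotientKerEquivOfSurjective π hsurj).symm.toEquiv

/-- Natural coordinates on the quotient by the centre. -/
theorem exists_coord {G : Type u} [Group G] {Q : Subgroup G} [Q.Normal] {π : G →* L22}
    (hker : π.ker = Q) (hcomm : ∀ x ∈ Q, ∀ y ∈ Q, x * y * x⁻¹ * y⁻¹ ∈ Z Q)
    (hsq : ∀ x ∈ Q, x ^ 2 ∈ Z Q) (σ : L22 →* G) (hσ : ∀ A, π (σ A) = A)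
    (hrot : ∀ x ∈ Q, σ rot * x * (σ rot)⁻¹ * x⁻¹ ∈ Z Q → x ∈ Z Q) :
    ∃ (U : Type u) (_ : AddCommGroup U) (_ : Module (ZMod 2) U)
      (p : Q →* Multiplicative (Fin 2 → U)), Function.Surjective p ∧
      (∀ (g : G) (x y : Q), (y : G) = g * x * g⁻¹ →
        (p y).toAdd = act (π g) (p x).toAdd) ∧ ∀ x : Q, p x = 1 ↔ (x : G) ∈ Z Q := by
  let K := Subgroup.center Q
  have hmk (x y : Q) : (x : Q ⧸ K) = y ↔ (x : G)⁻¹ * y ∈ Z Q := by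
    rw [QuotientGroup.eq, ← coe_mem_Z_iff]; rfl
  let _ : CommGroup (Q ⧸ K) :=
    { (inferInstance : Group (Q ⧸ K)) with
      mul_comm := by
        rintro ⟨x⟩ ⟨y⟩
        change ((x * y : Q) : Q ⧸ K) = (y * x : Q)
        rw [hmk]
        have := hcomm (y : G)⁻¹ (inv_mem y.2) (x : G)⁻¹ (inv_mem x.2)
        simp only [inv_inv] at this
        simpa [mul_assoc] using this }
  let W := Additive (Q ⧸ K)
  let _ : Module (ZMod 2) W := AddCommGroup.zmodModule (n := 2) (by
    intro x
    induction x using Additive.rec with | _ x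
    induction x using QuotientGroup.induction_on with | _ x
    change Additive.ofMul ((x ^ 2 : Q) : Q ⧸ K) = Additive.ofMul ((1 : Q) : Q ⧸ K)
    congr 1
    rw [hmk, ← inv_mem_iff]
    simpa using hsq x x.2)
  let mk : Q → W := fun x => Additive.ofMul (x : Q ⧸ K)
  have hind (P : W → Prop) (hP : ∀ x, P (mk x)) (w : W) : P w := by
    induction w using Additive.rec with | _ x
    induction x using QuotientGroup.induction_on with | _ x
    exact hP x
  have hK (g : G) : K ≤ K.comap (MulAut.conjNormal (H := Q) g).toMonoidHom := by
    intro x hx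
    rw [Subgroup.mem_comap, ← coe_mem_Z_iff]
    exact (MulAut.conjNormal_apply g x).symm ▸ (Z_normal Q).conj_mem _ ((coe_mem_Z_iff x).2 hx) g
  let T (g : G) : Module.End (ZMod 2) W :=
    (QuotientGroup.map K K (MulAut.conjNormal (H := Q) g).toMonoidHom
      (hK g)).toAdditive.toZModLinearMap 2
  have hT (g : G) (x : Q) : T g (mk x) = mk (MulAut.conjNormal g x) := rfl
  let ρ : L22 →* Module.End (ZMod 2) W :=
    { toFun := fun A => T (σ A)
      map_one' := by
        ext w
        revert w
        refine hind _ fun x => ?_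
        rw [map_one, hT, map_one]; rfl
      map_mul' := by
        intro A B
        ext w
        revert w
        refine hind _ fun x => ?_
        rw [Module.End.mul_apply, hT, hT, hT, map_mul, map_mul]; rfl }
  have hρ (A : L22) (x : Q) : ρ A (mk x) = mk (MulAut.conjNormal (σ A) x) := rfl
  have hmk0 (x : Q) : mk x = 0 ↔ (x : G) ∈ Z Q := by
    change (x : Q ⧸ K) = ((1 : Q) : Q ⧸ K) ↔ _
    rw [hmk, ← inv_mem_iff]; simp
  have hmksub (x y : Q) : mk (x * y⁻¹) = mk x - mk y := by
    rw [sub_eq_add_neg]; rfl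
  have hfix (w : W) : ρ rot w = w → w = 0 := by
    revert w
    refine hind _ fun x h => ?_
    rw [hρ, ← sub_eq_zero, ← hmksub, hmk0] at h
    rw [hmk0]
    refine hrot x x.2 ?_
    simpa [MulAut.conjNormal_apply] using h
  -- The orbit sum is fixed by `rot`, so it vanishes.
  have hsum (w : W) : w + ρ rot w + ρ rot (ρ rot w) = 0 := by
    apply hfix
    have hcube : ρ rot (ρ rot (ρ rot w)) = w := by
      have := congrArg (fun A => ρ A w) rot_cube
      simpa only [map_mul, map_one, Module.End.mul_apply, Module.End.one_apply] using this
    rw [map_add, map_add, hcube]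
    abel
  obtain ⟨U, e, he⟩ := exists_equiv_of_rot_sum ρ hsum
  refine ⟨U, inferInstance, inferInstance,
    { toFun := fun x => .ofAdd (e (mk x))
      map_one' := by
        rw [show mk 1 = 0 from rfl, map_zero]; rfl
      map_mul' := fun x y => by
        rw [show mk (x * y) = mk x + mk y from rfl, map_add]; rfl }, ?_, ?_, ?_⟩
  · intro w
    obtain ⟨w', hw'⟩ := e.surjective w.toAdd
    revert hw'
    refine hind (fun w' => e w' = _ → _) (fun x hx => ⟨x, ?_⟩) w'
    exact congrArg Multiplicative.ofAdd hx
  · intro g x y hy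
    change e (mk y) = act (π g) (e (mk x))
    rw [← he, hρ]
    congr 1
    change Additive.ofMul _ = Additive.ofMul _
    congr 1
    rw [hmk, MulAut.conjNormal_apply, hy]
    -- An arbitrary `g` differs from the chosen lift of its image by an element of `Q`, which acts
    -- trivially on the abelian quotient `Q / Z`.
    have hn : (σ (π g))⁻¹ * g ∈ Q := by
      rw [← hker, MonoidHom.mem_ker, map_mul, map_inv, hσ, inv_mul_cancel]
    have h := (Z_normal Q).conj_mem _ (hcomm _ hn _ (inv_mem x.2)) (σ (π g))
    have e : (g * (x : G) * g⁻¹)⁻¹ * (σ (π g) * x * (σ (π g))⁻¹) =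
      σ (π g) * ((σ (π g))⁻¹ * g * (x : G)⁻¹ * ((σ (π g))⁻¹ * g)⁻¹ * ((x : G)⁻¹)⁻¹) *
        (σ (π g))⁻¹ := by group
    rwa [e]
  · intro x
    refine Iff.trans ?_ (hmk0 x)
    exact e.map_eq_zero_iff

/-- A biextraspecial group has a framing. -/
theorem IsBiextraspecialWith.exists_framing {G : Type u} [Group G] {Q : Subgroup G} [Q.Normal]
    {m : ℕ} (h : IsBiextraspecialWith Q m) :
    ∃ (U : Type u) (_ : AddCommGroup U) (_ : Module (ZMod 2) U) (q : QuadraticForm (ZMod 2) U),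
      Nonempty (Framing Q q) := by
  have := h.finite
  obtain ⟨π, hsurj, hker, ⟨f, hfs, hf1, hfc⟩, hsec⟩ := h.exists_proj
  have hfi : Function.Injective f := (injective_iff_map_eq_one f).2 fun x hx =>
    Subtype.ext (Subgroup.mem_bot.1 ((hf1 x).1 hx))
  have hfix (g : G) (hg : π g = rot) (x : G) (hx : π x = 1) (hgx : g * x * g⁻¹ = x) : x = 1 := by
    have hxQ : x ∈ Q := by rw [← hker]; exact hx
    have hxZ : x ∈ Z Q := mem_Z_of_rot_fixed hsec hg hxQ (by rw [hgx, mul_inv_cancel]; exact one_mem _)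
    have h1 := hfc g ⟨x, hxZ⟩ ⟨x, hxZ⟩ hgx.symm
    rw [← act_eq_mulVec, hg] at h1
    have h2 : f ⟨x, hxZ⟩ = 1 := eq_zero_of_act_rot h1.symm
    exact Subgroup.mem_bot.1 ((hf1 _).1 h2)
  obtain ⟨σ, hσ⟩ := exists_section π hsurj hfix
  obtain ⟨U, i1, i2, p, hps, hpc, hp1⟩ := exists_coord hker h.comm_mem h.sq_mem σ hσ
    fun x hxQ hx => mem_Z_of_rot_fixed hsec (hσ rot) hxQ hx
  let e : Z Q ≃* Multiplicative NatMod := MulEquiv.ofBijective f ⟨hfi, hfs⟩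
  have hfe (v) : f (e.symm v) = v := e.apply_symm_apply v
  have hef (v) : e.symm (f v) = v := e.symm_apply_apply v
  have hcen (z : Z Q) (x : G) (hx : x ∈ Q) : x * z = z * x := by
    have := (coe_mem_Z_iff (⟨z, Z_le Q z.2⟩ : Q)).1 z.2
    exact congrArg Subtype.val (Subgroup.mem_center_iff.1 this ⟨x, hx⟩)
  have hsq (x : Q) : (x : G) * x ∈ Z Q := by
    have := h.sq_mem x x.2
    rwa [pow_two] at this
  have hk (x y : Q) : (x : G)⁻¹ * y * x * (y : G)⁻¹ ∈ Z Q := by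
    have := h.comm_mem (x : G)⁻¹ (inv_mem x.2) y y.2
    rwa [inv_inv] at this
  -- `F` is squaring and `k` a commutator, both read in the natural module. `F` descends to `Q / Z`
  -- because central elements square to 1. Its polar map is `k`, and additivity of `k` in the first
  -- argument makes the third difference of `F` vanish.
  let F (x : Q) : NatMod := (f ⟨x * x, hsq x⟩).toAdd
  let k (x y : Q) : NatMod := (f ⟨_, hk x y⟩).toAdd
  have hF (x y : Q) : F (x * y) = F x + F y + k x y := by
    rw [← toAdd_mul, ← toAdd_mul, ← map_mul, ← map_mul]
    refine congrArg (fun z => (f z).toAdd) (Subtype.ext ?_)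
    change (x * y : G) * (x * y) = x * x * (y * y) * ((x : G)⁻¹ * y * x * (y : G)⁻¹)
    rw [mul_assoc _ ((y : G) * y), hcen ⟨_, hk x y⟩ _ (mul_mem y.2 y.2)]
    group
  have hk_add (x y z : Q) : k (x * y) z = k x z + k y z := by
    rw [← toAdd_mul, ← map_mul]
    refine congrArg (fun z => (f z).toAdd) (Subtype.ext ?_)
    change (x * y : G)⁻¹ * z * (x * y) * (z : G)⁻¹ =
      ((x : G)⁻¹ * z * x * (z : G)⁻¹) * ((y : G)⁻¹ * z * y * (z : G)⁻¹)
    have := hcen ⟨_, hk x z⟩ (y : G)⁻¹ (inv_mem y.2)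
    simp only at this
    calc _ = ((y : G)⁻¹ * ((x : G)⁻¹ * z * x * (z : G)⁻¹)) * z * y * (z : G)⁻¹ := by group
      _ = _ := by rw [this]; group
  have hF_cen (x : Q) (hx : (x : G) ∈ Z Q) : F x = 0 := by
    have : F x = (f ⟨x, hx⟩).toAdd + (f ⟨x, hx⟩).toAdd := by
      rw [← toAdd_mul, ← map_mul]; rfl
    rw [this, add_self_eq_zero']
  have hk_cen (x y : Q) (hy : (y : G) ∈ Z Q) : k x y = 0 := by
    have e : (⟨_, hk x y⟩ : Z Q) = 1 := by
      apply Subtype.ext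
      have := hcen ⟨y, hy⟩ x x.2
      simp only at this
      change (x : G)⁻¹ * y * x * (y : G)⁻¹ = 1
      rw [mul_assoc _ (y : G), ← this]; group
    change (f ⟨_, hk x y⟩).toAdd = 0
    rw [e, map_one]; rfl
  have hF_congr (x y : Q) (hxy : p x = p y) : F x = F y := by
    have h1 : ((x⁻¹ * y : Q) : G) ∈ Z Q := by rw [← hp1, map_mul, map_inv, hxy, inv_mul_cancel]
    have h2 := hF x (x⁻¹ * y)
    rw [hF_cen _ h1, hk_cen _ _ h1, mul_inv_cancel_left] at h2
    simpa using h2.symm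
  choose ℓ hℓ using fun w => hps (Multiplicative.ofAdd w)
  have hsF (x : Q) : F (ℓ (p x).toAdd) = F x := hF_congr _ _ (hℓ _)
  have hex (w : Fin 2 → U) : ∃ x, (p x).toAdd = w := ⟨ℓ w, by rw [hℓ]; rfl⟩
  obtain ⟨q, hq⟩ := exists_eq_sqMap (fun w => F (ℓ w))
    (by
      intro A w
      obtain ⟨x, rfl⟩ := hex w
      have h1 := hpc (σ A) x ⟨σ A * x * (σ A)⁻¹, Subgroup.Normal.conj_mem inferInstance _ x.2 _⟩ rfl
      rw [hσ] at h1
      rw [← h1, hsF, hsF]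
      have h2 := hfc (σ A) ⟨_, hsq x⟩ ⟨_, hsq ⟨σ A * x * (σ A)⁻¹, Subgroup.Normal.conj_mem inferInstance _ x.2 _⟩⟩
        (by simp only; group)
      rwa [hσ, ← act_eq_mulVec] at h2)
    (hF_cen _ (by rw [← hp1, hℓ]; rfl))
    (by
      intro w₁ w₂ w₃
      obtain ⟨x, rfl⟩ := hex w₁
      obtain ⟨y, rfl⟩ := hex w₂
      obtain ⟨z, rfl⟩ := hex w₃
      simp only [← toAdd_mul, ← map_mul, hsF, hF, hk_add]
      have e1 := add_self_eq_zero' (F x + F y + F z + k x y + k x z + k y z)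
      have e2 := add_self_eq_zero' (F x + F y + F z)
      rw [← add_zero (0 : NatMod)]
      nth_rw 1 [← e1]
      rw [← e2]
      abel)
  refine ⟨U, i1, i2, q, ⟨?_⟩⟩
  refine
    { proj := π
      proj_surj := hsurj
      ker_proj := hker
      coord := p
      coord_surj := hps
      coord_conj := hpc
      coord_eq_one_iff := hp1
      cen := (Subgroup.inclusion (Z_le Q)).comp e.symm.toMonoidHom
      cen_inj := (Subgroup.inclusion_injective (Z_le Q)).comp e.symm.injective
      cen_conj := ?_
      range_cen := ?_
      mul_self := ?_ }
  · intro g v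
    have h1 := hfc g (e.symm (.ofAdd v)) ⟨g * e.symm (.ofAdd v) * g⁻¹,
      (Z_normal Q).conj_mem _ (Subtype.prop _) _⟩ rfl
    rw [hfe, ← act_eq_mulVec] at h1
    change ((e.symm (.ofAdd (act (π g) (Multiplicative.ofAdd v).toAdd)) : Z Q) : G) = _
    rw [← h1, ofAdd_toAdd, hef]; rfl
  · intro x
    constructor
    · intro hx
      exact ⟨(f ⟨x, hx⟩).toAdd, by rw [ofAdd_toAdd]; exact congrArg (Subgroup.inclusion (Z_le Q)) (hef ⟨x, hx⟩)⟩
    · rintro ⟨v, rfl⟩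
      exact (e.symm (.ofAdd v)).2
  · intro x
    rw [← hq]
    simp only [hsF]
    exact (congrArg (Subgroup.inclusion (Z_le Q)) (hef ⟨_, hsq x⟩)).symm

/-! ### The cocycle and the model group -/

section Cocycle

variable {U : Type*} [AddCommGroup U] [Module (ZMod 2) U] (β : LinearMap.BilinForm (ZMod 2) U)

/-- The tensor product of a bilinear form with the commutative `L₂(2)`-equivariant multiplication
on the natural module. -/
def cocycle (w w' : Fin 2 → U) : NatMod :=
  fun i => β (w i) (w' i) + (β (w 0) (w' 1) + β (w 1) (w' 0))

theorem cocycle_add_left (w₁ w₂ w' : Fin 2 → U) :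
    cocycle β (w₁ + w₂) w' = cocycle β w₁ w' + cocycle β w₂ w' := by
  ext i; simp only [cocycle, Pi.add_apply, map_add, LinearMap.add_apply]; ring

theorem cocycle_add_right (w w₁ w₂ : Fin 2 → U) :
    cocycle β w (w₁ + w₂) = cocycle β w w₁ + cocycle β w w₂ := by
  ext i; simp only [cocycle, Pi.add_apply, map_add]; ring

@[simp] theorem cocycle_zero_left (w : Fin 2 → U) : cocycle β 0 w = 0 := by
  ext i; simp [cocycle]

@[simp] theorem cocycle_zero_right (w : Fin 2 → U) : cocycle β w 0 = 0 := by
  ext i; simp [cocycle]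

/-- If the natural module is identified with GF(4), `rot` being multiplication by a generator ω and
`tau` the Frobenius map, the product used in `cocycle` is (a, b) ↦ (ab)². It commutes with
Frobenius, and also with multiplication by ω because ω⁴ = ω. -/
theorem cocycle_act (A : L22) (w w' : Fin 2 → U) :
    cocycle β (act A w) (act A w') = act A (cocycle β w w') := by
  induction A using L22_induction with
  | one => simp [act_one]
  | tau_mul A ih =>
    simp only [act_mul, act_tau (act A w), act_tau (act A w'), ← ih]
    rw [act_tau]
    ext i; fin_cases i <;>
      simp only [cocycle, Fin.zero_eta, Fin.mk_one, Matrix.cons_val_zero, Matrix.cons_val_one,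
        Matrix.cons_val_fin_one, map_add, LinearMap.add_apply]
    all_goals
      generalize β (act A w 0) (act A w' 0) = a
      generalize β (act A w 0) (act A w' 1) = b
      generalize β (act A w 1) (act A w' 0) = c
      generalize β (act A w 1) (act A w' 1) = d
      clear * -
      decide +revert
  | rot_mul A ih =>
    simp only [act_mul, act_rot (act A w), act_rot (act A w'), ← ih]
    rw [act_rot]
    ext i; fin_cases i <;>
      simp only [cocycle, Fin.zero_eta, Fin.mk_one, Matrix.cons_val_zero, Matrix.cons_val_one,
        Matrix.cons_val_fin_one, map_add, LinearMap.add_apply]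
    all_goals
      generalize β (act A w 0) (act A w' 0) = a
      generalize β (act A w 0) (act A w' 1) = b
      generalize β (act A w 1) (act A w' 0) = c
      generalize β (act A w 1) (act A w' 1) = d
      clear * -
      decide +revert

theorem cocycle_self (w : Fin 2 → U) :
    cocycle β w w = sqMap (LinearMap.BilinMap.toQuadraticMap β) w := by
  ext i
  simp [cocycle, sqMap, LinearMap.BilinMap.polar_toQuadraticMap]

end Cocycle

/-- The 2-group of the model: the central extension defined by the cocycle of `β`. -/
@[ext] structure Model {U : Type*} [AddCommGroup U] [Module (ZMod 2) U]
    (β : LinearMap.BilinForm (ZMod 2) U) where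
  vec : Fin 2 → U
  cen : NatMod

namespace Model

variable {U : Type*} [AddCommGroup U] [Module (ZMod 2) U] {β : LinearMap.BilinForm (ZMod 2) U}

instance : Mul (Model β) := ⟨fun x y => ⟨x.vec + y.vec, x.cen + y.cen + cocycle β x.vec y.vec⟩⟩
instance : One (Model β) := ⟨⟨0, 0⟩⟩
instance : Inv (Model β) := ⟨fun x => ⟨x.vec, x.cen + cocycle β x.vec x.vec⟩⟩

@[simp] theorem mul_vec (x y : Model β) : (x * y).vec = x.vec + y.vec := rfl
@[simp] theorem mul_cen (x y : Model β) :
    (x * y).cen = x.cen + y.cen + cocycle β x.vec y.vec := rfl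
@[simp] theorem one_vec : (1 : Model β).vec = 0 := rfl
@[simp] theorem one_cen : (1 : Model β).cen = 0 := rfl
@[simp] theorem inv_vec (x : Model β) : x⁻¹.vec = x.vec := rfl
@[simp] theorem inv_cen (x : Model β) : x⁻¹.cen = x.cen + cocycle β x.vec x.vec := rfl

instance : Group (Model β) := Group.ofLeftAxioms
  (fun x y z => by
    ext1
    · simp [add_assoc]
    · simp only [mul_cen, mul_vec, cocycle_add_left, cocycle_add_right]; abel)
  (fun x => by ext1 <;> simp)
  (fun x => by
    ext1
    · simp [add_self_eq_zero']
    · have := add_self_eq_zero' (x.cen + cocycle β x.vec x.vec)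
      simp only [mul_cen, inv_cen, inv_vec, one_cen]
      rw [← this]; abel)

variable (β) in
/-- The action of `L₂(2)` on the 2-group of the model. -/
def action : L22 →* MulAut (Model β) where
  toFun A :=
    { toFun := fun x => ⟨act A x.vec, act A x.cen⟩
      invFun := fun x => ⟨act A⁻¹ x.vec, act A⁻¹ x.cen⟩
      left_inv := fun x => by simp [← act_mul, act_one]
      right_inv := fun x => by simp [← act_mul, act_one]
      map_mul' := fun x y => by ext1 <;> simp [act_add, cocycle_act] }
  map_one' := by ext x : 2 <;> simp [act_one]
  map_mul' A B := by ext x : 2 <;> simp [act_mul]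

theorem action_apply (A : L22) (x : Model β) : action β A x = ⟨act A x.vec, act A x.cen⟩ := rfl

end Model

/-! ### Framed groups are isomorphic to the model -/

namespace Framing

variable {G : Type*} [Group G] {Q : Subgroup G} {U : Type*} [AddCommGroup U]
  [Module (ZMod 2) U] {q : QuadraticForm (ZMod 2) U}

theorem coord_cen (F : Framing Q q) (v : NatMod) : F.coord (F.cen (.ofAdd v)) = 1 :=
  (F.coord_eq_one_iff _).2 ((F.range_cen _).2 ⟨v, rfl⟩)

theorem mul_cen_comm (F : Framing Q q) (v : NatMod) (x : Q) : x * F.cen (.ofAdd v) = F.cen (.ofAdd v) * x :=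
  Subgroup.mem_center_iff.1 ((coe_mem_Z_iff _).1 ((F.range_cen _).2 ⟨v, rfl⟩)) x

theorem mem_iff (F : Framing Q q) (g : G) : g ∈ Q ↔ F.proj g = 1 := by
  exact (SetLike.ext_iff.1 F.ker_proj g).symm

theorem eq_one_of_rot_fixed (F : Framing Q q) {g : G} (hg : F.proj g = rot) (x : Q) (h : g * x * g⁻¹ = x) :
    x = 1 := by
  have h1 := F.coord_conj g x x h.symm
  rw [hg] at h1
  have h2 : F.coord x = 1 := eq_zero_of_act_rot h1.symm
  obtain ⟨v, rfl⟩ := (F.range_cen x).1 ((F.coord_eq_one_iff x).1 h2)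
  rw [← F.cen_conj, hg] at h
  have h3 : act rot v = v := F.cen_inj (Subtype.ext h)
  rw [eq_zero_of_act_rot h3]
  exact map_one _

theorem exists_section (F : Framing Q q) [Finite Q] : ∃ σ : L22 →* G, ∀ A, F.proj (σ A) = A := by
  have : Finite F.proj.ker := by rw [F.ker_proj]; infer_instance
  refine Biextraspecial.exists_section F.proj F.proj_surj fun g hg x hx h => ?_
  have hxQ : x ∈ Q := (F.mem_iff x).2 hx
  exact congrArg Subtype.val (F.eq_one_of_rot_fixed hg ⟨x, hxQ⟩ h)

/-- The operation x + y = xy·c(x, y), with c the central value of the cocycle, is associative by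
biadditivity. Also x + x = x²·c(x, x) = 1 since `β` is `q` on the diagonal, so the operation has
exponent two and is commutative. Conjugation by the complement is linear for it, and `r` is a linear
equivariant section of the projection. -/
theorem exists_lift (F : Framing Q q) [Q.Normal] (β : LinearMap.BilinForm (ZMod 2) U)
    (hβ : LinearMap.BilinMap.toQuadraticMap β = q) (σ : L22 →* G) (hσ : ∀ A, F.proj (σ A) = A) :
    ∃ r : (Fin 2 → U) → Q, (∀ w, F.coord (r w) = .ofAdd w) ∧
      (∀ w w', r (w + w') = r w * r w' * F.cen (.ofAdd (cocycle β w w'))) ∧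
      ∀ A w, r (act A w) = MulAut.conjNormal (σ A) (r w) := by
  let p (x : Q) : Fin 2 → U := (F.coord x).toAdd
  let c (v : NatMod) : Q := F.cen (.ofAdd v)
  have hpm (x y : Q) : p (x * y) = p x + p y := by simp [p]
  have hpc (v : NatMod) : p (c v) = 0 := F.coord_cen v
  have hcm (v : NatMod) (x : Q) : x * c v = c v * x := F.mul_cen_comm v x
  have hca (v v' : NatMod) : c (v + v') = c v * c v' := by simp [c]
  have hc0 : c 0 = 1 := map_one _
  have hconj (A : L22) (x : Q) : p (MulAut.conjNormal (σ A) x) = act A (p x) := by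
    have := F.coord_conj (σ A) x (MulAut.conjNormal (σ A) x) (MulAut.conjNormal_apply _ _)
    rwa [hσ] at this
  have hconjc (A : L22) (v : NatMod) : MulAut.conjNormal (σ A) (c v) = c (act A v) := by
    apply Subtype.ext
    have := F.cen_conj (σ A) v
    rw [hσ] at this
    rw [MulAut.conjNormal_apply, ← this]
  let _ : Add Q := ⟨fun x y => x * y * c (cocycle β (p x) (p y))⟩
  let _ : Zero Q := ⟨1⟩
  let _ : Neg Q := ⟨fun x => x⟩
  have hadd (x y : Q) : x + y = x * y * c (cocycle β (p x) (p y)) := rfl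
  have hzero : (0 : Q) = 1 := rfl
  have hneg (x : Q) : -x = x := rfl
  have hp1 : p 1 = 0 := congrArg Multiplicative.toAdd (map_one F.coord)
  have hpadd (x y : Q) : p (x + y) = p x + p y := by
    rw [hadd, hpm, hpm, hpc, add_zero]
  have hself (x : Q) : x + x = 0 := by
    rw [hadd, hzero, F.mul_self x, cocycle_self, hβ]
    change c _ * c _ = 1
    rw [← hca, add_self_eq_zero', hc0]
  let _ : AddGroup Q := AddGroup.ofLeftAxioms
    (fun x y z => by
      rw [hadd (x + y) z, hadd x (y + z), hpadd, hpadd, cocycle_add_left, cocycle_add_right,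
        hadd x y, hadd y z, hca, hca]
      generalize cocycle β (p x) (p y) = a
      generalize cocycle β (p y) (p z) = b
      generalize cocycle β (p x) (p z) = d
      rw [mul_assoc (x * y), ← hcm a z, ← mul_assoc x, ← mul_assoc x, ← mul_assoc (x * y),
        mul_assoc, mul_assoc _ (c b), ← hca, ← hca, ← hca, ← hca]
      congr 2
      abel)
    (fun x => by rw [hadd, hzero, hp1, cocycle_zero_left, hc0, one_mul, mul_one])
    (fun x => hself x)
  let _ : AddCommGroup Q :=
    { (inferInstance : AddGroup Q) with
      add_comm := fun x y => by
        have h : x + ((x + y) + (x + y)) + y = x + y := by rw [hself, add_zero]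
        rw [← h, add_assoc x y, ← add_assoc x x, hself, zero_add, add_assoc, add_assoc, hself,
          add_zero] }
  let _ : Module (ZMod 2) Q := AddCommGroup.zmodModule (n := 2) fun x => by
    rw [two_nsmul]; exact hself x
  let ρ : L22 →* Module.End (ZMod 2) Q :=
    { toFun := fun A => AddMonoidHom.toZModLinearMap 2 (AddMonoidHom.mk'
        (fun x => MulAut.conjNormal (σ A) x) (fun x y => by
          rw [hadd, hadd, map_mul, map_mul, hconjc, hconj, hconj, cocycle_act]))
      map_one' := by
        ext x : 1
        change MulAut.conjNormal (σ 1) x = x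
        rw [map_one, map_one]; rfl
      map_mul' := fun A B => by
        ext x : 1
        change MulAut.conjNormal (σ (A * B)) x =
          MulAut.conjNormal (σ A) (MulAut.conjNormal (σ B) x)
        rw [map_mul, map_mul]; rfl }
  have hρ (A : L22) (x : Q) : ρ A x = MulAut.conjNormal (σ A) x := rfl
  -- The zero of the twisted group is the identity of `Q`, so fixed-point-freeness of `rot` on `Q`
  -- applies directly.
  have hsum (x : Q) : x + ρ rot x + ρ rot (ρ rot x) = 0 := by
    refine F.eq_one_of_rot_fixed (hσ rot) _ ?_
    rw [← MulAut.conjNormal_apply]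
    refine congrArg Subtype.val ((hρ _ _).symm.trans ?_)
    have hcube : ρ rot (ρ rot (ρ rot x)) = x := by
      have := congrArg (fun A => ρ A x) rot_cube
      simpa only [map_mul, map_one, Module.End.mul_apply, Module.End.one_apply] using this
    rw [map_add, map_add, hcube]
    abel
  let P : Q →ₗ[ZMod 2] (Fin 2 → U) := (AddMonoidHom.mk' p hpadd).toZModLinearMap 2
  have hPρ (A : L22) (x : Q) : P (ρ A x) = act A (P x) := hconj A x
  let E : Submodule (ZMod 2) Q := LinearMap.ker (ρ tau - LinearMap.id)
  have hE (x : Q) : x ∈ E ↔ ρ tau x = x := by simp [E, sub_eq_zero]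
  have hPE (x : Q) (hx : x ∈ E) : P x = ![P x 0, 0] := by
    have h := hPρ tau x
    rw [(hE x).1 hx, act_tau] at h
    have h0 := congrFun h 0
    ext i; fin_cases i
    · rfl
    · simpa using h0
  let f : E →ₗ[ZMod 2] U := (LinearMap.proj 0).comp (P.comp E.subtype)
  have hf : Function.Surjective f := by
    intro u
    obtain ⟨y, hy⟩ := F.coord_surj (.ofAdd ![0, u])
    have hy' : P y = ![0, u] := hy
    -- The norm y + tau y is fixed by `tau`, and it lies over (0, u) + (u, u) = (u, 0).
    refine ⟨⟨y + ρ tau y, ?_⟩, ?_⟩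
    · rw [hE, map_add, ← Module.End.mul_apply, ← map_mul, tau_mul_tau, map_one,
        Module.End.one_apply, add_comm]
    · change P (y + ρ tau y) 0 = u
      rw [map_add, hPρ, act_tau, hy']
      simp
  obtain ⟨j, hj⟩ := LinearMap.exists_rightInverse_of_surjective f (LinearMap.range_eq_top.2 hf)
  have hPj (u : U) : P (j u) = ![u, 0] := by
    rw [hPE _ (j u).2]
    congr 1
    exact LinearMap.congr_fun hj u
  let r (w : Fin 2 → U) : Q := (j (w 0) : Q) + ρ rot (j (w 1))
  have hpr (w : Fin 2 → U) : p (r w) = w := by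
    change P ((j (w 0) : Q) + ρ rot (j (w 1))) = w
    rw [map_add, hPρ, hPj, hPj, act_rot]
    ext i; fin_cases i <;> simp
  refine ⟨r, hpr, fun w w' => ?_, fun A w => ?_⟩
  · have h : r (w + w') = r w + r w' := by
      simp only [r, Pi.add_apply, map_add, Submodule.coe_add]
      abel
    rw [h, hadd, hpr, hpr]
  · exact equivariant_extend ρ hsum (E.subtype.comp j) (fun u => (hE _).1 (j u).2) A w

theorem nonempty_mulEquiv (F : Framing Q q) [Finite Q] [Q.Normal] (β : LinearMap.BilinForm (ZMod 2) U)
    (hβ : LinearMap.BilinMap.toQuadraticMap β = q) :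
    Nonempty (Model β ⋊[Model.action β] L22 ≃* G) := by
  obtain ⟨σ, hσ⟩ := F.exists_section
  obtain ⟨r, hr, hmul, hact⟩ := F.exists_lift β hβ σ hσ
  have hr0 : r 0 = 1 := by
    have := hmul 0 0
    rw [add_zero, cocycle_zero_left, ofAdd_zero, map_one, mul_one] at this
    exact left_eq_mul.1 this
  let f₁ : Model β →* Q := MonoidHom.mk' (fun x => r x.vec * F.cen (.ofAdd x.cen)) (by
    intro x y
    have h2 := add_self_eq_zero' (cocycle β x.vec y.vec)
    have e : F.cen (.ofAdd (cocycle β x.vec y.vec)) * F.cen (.ofAdd (x * y).cen) =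
        F.cen (.ofAdd x.cen) * F.cen (.ofAdd y.cen) := by
      rw [← map_mul F.cen, ← map_mul F.cen, ← ofAdd_add, ← ofAdd_add, Model.mul_cen]
      congr 2
      rw [add_left_comm, h2, add_zero]
    rw [Model.mul_vec, hmul, mul_assoc, e, mul_assoc, mul_assoc, ← mul_assoc (F.cen _) (r _),
      ← F.mul_cen_comm x.cen (r y.vec), mul_assoc])
  have hf₁ (x : Model β) : f₁ x = r x.vec * F.cen (.ofAdd x.cen) := rfl
  let f : Model β ⋊[Model.action β] L22 →* G :=
    SemidirectProduct.lift (Q.subtype.comp f₁) σ (by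
      intro A
      ext x
      change ((f₁ (Model.action β A x) : Q) : G) = σ A * (f₁ x : Q) * (σ A)⁻¹
      rw [← MulAut.conjNormal_apply, hf₁, hf₁, Model.action_apply, map_mul, ← hact]
      congr 2
      apply Subtype.ext
      rw [MulAut.conjNormal_apply, ← F.cen_conj, hσ])
  have hf (x) : f x = (f₁ x.left : Q) * σ x.right := rfl
  have hproj (x) : F.proj (f x) = x.right := by
    rw [hf, map_mul, (F.mem_iff _).1 (f₁ x.left).2, one_mul, hσ]
  refine ⟨MulEquiv.ofBijective f ⟨(injective_iff_map_eq_one f).2 fun x hx => ?_, fun g => ?_⟩⟩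
  · have h1 : x.right = 1 := by rw [← hproj, hx, map_one]
    have h2 : f₁ x.left = 1 := by
      rw [hf, h1, map_one, mul_one] at hx
      exact Subtype.ext hx
    rw [hf₁] at h2
    have h3 := congrArg F.coord h2
    rw [map_mul, F.coord_cen, hr, mul_one, map_one] at h3
    have h4 : x.left.vec = 0 := h3
    rw [h4, hr0, one_mul] at h2
    have h5 : x.left.cen = 0 := F.cen_inj (h2.trans (map_one F.cen).symm)
    ext1
    · exact Model.ext h4 h5
    · exact h1
  · have hg : g * (σ (F.proj g))⁻¹ ∈ Q := by
      rw [F.mem_iff, map_mul, map_inv, hσ, mul_inv_cancel]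
    let x : Q := ⟨_, hg⟩
    have h1 : F.coord ((r (F.coord x).toAdd)⁻¹ * x) = 1 := by
      rw [map_mul, map_inv, hr, ofAdd_toAdd, inv_mul_cancel]
    obtain ⟨v, hv⟩ := (F.range_cen _).1 ((F.coord_eq_one_iff _).1 h1)
    refine ⟨⟨⟨(F.coord x).toAdd, v⟩, F.proj g⟩, ?_⟩
    rw [hf, hf₁]
    simp only
    rw [hv, mul_inv_cancel_left]
    simp [x]

end Framing

/-! ### Framed groups are biextraspecial -/

theorem tens_single_add {U : Type*} [AddCommGroup U] [Module (ZMod 2) U] (w : Fin 2 → U) :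
    tens ![1, 0] (w 0) + tens ![0, 1] (w 1) = w := by
  ext i; fin_cases i <;> simp [tens]

namespace Framing

variable {G : Type*} [Group G] {Q : Subgroup G} {U : Type*} [AddCommGroup U]
  [Module (ZMod 2) U] {q : QuadraticForm (ZMod 2) U}

theorem card_eq [Finite Q] (F : Framing Q q) : Nat.card Q = 4 * Nat.card U ^ 2 := by
  have h1 : Nat.card F.coord.ker = 4 := by
    have e : F.coord.ker = F.cen.range := by
      ext x
      rw [MonoidHom.mem_ker, F.coord_eq_one_iff, F.range_cen, MonoidHom.mem_range]
      exact Iff.rfl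
    rw [e, Nat.card_congr (MonoidHom.ofInjective F.cen_inj).toEquiv.symm]
    simp
  rw [← F.coord.ker.card_mul_index, h1, Subgroup.index_ker, MonoidHom.range_eq_top.2 F.coord_surj,
    Subgroup.card_top]
  change 4 * Nat.card (Fin 2 → U) = _
  rw [Nat.card_fun]
  simp

theorem mem_Z_iff (F : Framing Q q) (x : G) :
    x ∈ Z Q ↔ ∃ hx : x ∈ Q, F.coord ⟨x, hx⟩ = 1 :=
  ⟨fun h => ⟨Z_le Q h, (F.coord_eq_one_iff _).2 h⟩, fun ⟨_, h⟩ => (F.coord_eq_one_iff _).1 h⟩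

/-- The coordinates of the elements of a subgroup. -/
def image (F : Framing Q q) (N : Subgroup G) : AddSubgroup (Fin 2 → U) where
  carrier := {w | ∃ x : Q, (x : G) ∈ N ∧ (F.coord x).toAdd = w}
  zero_mem' := ⟨1, one_mem N, by rw [map_one]; rfl⟩
  add_mem' := by
    rintro _ _ ⟨x, hx, rfl⟩ ⟨y, hy, rfl⟩
    exact ⟨x * y, mul_mem hx hy, by rw [map_mul]; rfl⟩
  neg_mem' := by
    rintro _ ⟨x, hx, rfl⟩
    exact ⟨x⁻¹, inv_mem hx, by rw [map_inv]; rfl⟩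

theorem coord_mem_image (F : Framing Q q) {N : Subgroup G} (hZ : Z Q ≤ N) (x : Q) :
    (F.coord x).toAdd ∈ F.image N ↔ (x : G) ∈ N := by
  refine ⟨fun ⟨y, hy, e⟩ => ?_, fun h => ⟨x, h, rfl⟩⟩
  have h1 : F.coord (y⁻¹ * x) = 1 := by
    rw [map_mul, map_inv, show F.coord y = F.coord x from e, inv_mul_cancel]
  have h2 := mul_mem hy (hZ ((F.coord_eq_one_iff _).1 h1))
  simpa using h2

theorem act_mem_image [hQ : Q.Normal] (F : Framing Q q) {N : Subgroup G} (hN : N.Normal) (A : L22)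
    {w : Fin 2 → U} (hw : w ∈ F.image N) : act A w ∈ F.image N := by
  obtain ⟨x, hx, rfl⟩ := hw
  obtain ⟨g, rfl⟩ := F.proj_surj A
  exact ⟨⟨_, hQ.conj_mem _ x.2 g⟩, hN.conj_mem _ hx g, F.coord_conj g x _ rfl⟩

theorem tens_mem_image_of_ne [Q.Normal] (F : Framing Q q) {N : Subgroup G} (hN : N.Normal)
    {v v' : NatMod} {u : U} (hv : v ≠ 0) (h : tens v u ∈ F.image N) : tens v' u ∈ F.image N := by
  by_cases hv' : v' = 0
  · have : tens v' u = 0 := by ext i; simp [tens, hv']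
    rw [this]
    exact zero_mem _
  · obtain ⟨A, rfl⟩ := exists_act_eq hv hv'
    rw [← act_tens]
    exact F.act_mem_image hN A h

/-- Submodules of a multiple of the natural module are determined by a subspace of coefficients.
Indeed (1 + tau) w is the first basis vector tensored with `w 1`, transitivity on nonzero vectors
gives every other `v`, and rot² moves `w 0` into position 1. -/
theorem tens_mem_image [Q.Normal] (F : Framing Q q) {N : Subgroup G} (hN : N.Normal)
    {w : Fin 2 → U} (hw : w ∈ F.image N) (i : Fin 2) (v : NatMod) :
    tens v (w i) ∈ F.image N := by
  have h1 (w) (hw : w ∈ F.image N) : tens ![1, 0] (w 1) ∈ F.image N := by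
    have h := add_mem hw (F.act_mem_image hN tau hw)
    rw [act_tau] at h
    convert h using 1
    ext i; fin_cases i
    · simp [tens, add_add_self']
    · simp [tens, add_self_eq_zero']
  have hne : (![1, 0] : NatMod) ≠ 0 := by decide
  fin_cases i
  · have h2 := h1 _ (F.act_mem_image hN (rot * rot) hw)
    rw [act_mul, act_rot, act_rot] at h2
    have e : w 1 + (w 0 + w 1) = w 0 := by rw [add_comm (w 0), add_add_self']
    simp only [Matrix.cons_val_zero, Matrix.cons_val_one, Matrix.cons_val_fin_one, e] at h2
    exact F.tens_mem_image_of_ne hN hne h2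
  · exact F.tens_mem_image_of_ne hN hne (h1 w hw)

theorem isNaturalSection [Q.Normal] (F : Framing Q q) {A B : Subgroup G} (hA : A.Normal)
    (hB : B.Normal) (hZA : Z Q ≤ A) (hBQ : B ≤ Q) (h : IsIrreducibleSection A B) :
    IsNaturalSection F.proj A B := by
  obtain ⟨hAB, hirr⟩ := h
  obtain ⟨b₀, hb₀, hb₀A⟩ := SetLike.exists_of_lt hAB
  let UA : Submodule (ZMod 2) U := AddSubgroup.toZModSubmodule 2
    { carrier := {u | tens ![1, 0] u ∈ F.image A}
      zero_mem' := by
        change tens ![1, 0] 0 ∈ F.image A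
        have : tens ![1, 0] (0 : U) = 0 := by ext i; simp [tens]
        rw [this]; exact zero_mem _
      add_mem' := by
        intro u u' hu hu'
        have := add_mem (show tens _ u ∈ F.image A from hu) (show tens _ u' ∈ F.image A from hu')
        have e : tens ![1, 0] (u + u') = tens ![1, 0] u + tens ![1, 0] u' := by ext i; simp [tens]
        change tens ![1, 0] (u + u') ∈ F.image A
        rwa [e]
      neg_mem' := by
        intro u hu
        rwa [neg_eq_self'] }
  have hUA (u : U) : u ∈ UA ↔ tens ![1, 0] u ∈ F.image A := Iff.rfl
  obtain ⟨i, hi⟩ : ∃ i, (F.coord ⟨b₀, hBQ hb₀⟩).toAdd i ∉ UA := by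
    by_contra! hcon
    apply hb₀A
    rw [← F.coord_mem_image hZA ⟨b₀, hBQ hb₀⟩, ← tens_single_add (F.coord _).toAdd]
    exact add_mem ((hUA _).1 (hcon 0))
      (F.tens_mem_image_of_ne hA (v := ![1, 0]) (by decide) ((hUA _).1 (hcon 1)))
  set u₀ := (F.coord ⟨b₀, hBQ hb₀⟩).toAdd i with hu₀
  -- A linear form on `U` that kills the coefficients of `A` but not `u₀`, applied coordinatewise,
  -- is an equivariant map from `B` to the natural module. Its kernel is normal, contains `A` and is
  -- not `B`, so irreducibility forces it to be `A`.
  obtain ⟨l, hl, hlA⟩ := Submodule.exists_le_ker_of_notMem hi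
  have hl1 : l u₀ = 1 := (zmod_two_cases _).resolve_left hl
  let f : B →* Multiplicative NatMod := MonoidHom.mk'
    (fun b => .ofAdd fun j => l ((F.coord ⟨b, hBQ b.2⟩).toAdd j)) (fun b c => by
      have e : F.coord ⟨(b * c : B), hBQ (b * c).2⟩ =
        F.coord ⟨b, hBQ b.2⟩ * F.coord ⟨c, hBQ c.2⟩ := by rw [← map_mul]; rfl
      rw [e, ← ofAdd_add]
      congr 1
      ext j
      simp)
  have hf (b : B) (j) : (f b).toAdd j = l ((F.coord ⟨b, hBQ b.2⟩).toAdd j) := rfl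
  have hconj (g : G) (b c : B) (hc : (c : G) = g * b * g⁻¹) :
      (f c).toAdd = act (F.proj g) (f b).toAdd := by
    ext j
    rw [hf, F.coord_conj g ⟨b, hBQ b.2⟩ ⟨c, hBQ c.2⟩ hc]
    simp [act, hf]
  have hK : f.ker.map B.subtype = A := by
    refine (hirr _ ⟨?_⟩ ?_ (Subgroup.map_subtype_le _)).resolve_right ?_
    · rintro _ ⟨b, hb, rfl⟩ g
      refine ⟨⟨_, hB.conj_mem _ b.2 g⟩, ?_, rfl⟩
      have h1 := hconj g b ⟨_, hB.conj_mem _ b.2 g⟩ rfl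
      have h2 : (f b).toAdd = 0 := hb
      rw [h2, act_zero] at h1
      exact h1
    · intro a ha
      refine ⟨⟨a, hAB.le ha⟩, ?_, rfl⟩
      change (f _).toAdd = 0
      ext j
      rw [hf]
      exact hlA ((hUA _).2 (F.tens_mem_image hA
        ((F.coord_mem_image hZA ⟨a, hBQ (hAB.le ha)⟩).2 ha) j _))
    · intro e
      have : b₀ ∈ f.ker.map B.subtype := e.symm.le hb₀
      obtain ⟨b, hb, e⟩ := this
      have h2 : (f b).toAdd = 0 := hb
      have h3 := congrFun h2 i
      have e' : (⟨b, hBQ b.2⟩ : Q) = ⟨b₀, hBQ hb₀⟩ := Subtype.ext e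
      rw [hf, e', ← hu₀, hl1] at h3
      exact one_ne_zero (α := ZMod 2) h3
  refine ⟨f, ?_, ?_, ?_⟩
  · intro v
    obtain ⟨x, hx, hxe⟩ := F.tens_mem_image hB
      ((F.coord_mem_image (hZA.trans hAB.le) ⟨b₀, hBQ hb₀⟩).2 hb₀) i v.toAdd
    refine ⟨⟨x, hx⟩, ?_⟩
    change (f _).toAdd = v.toAdd
    ext j
    rw [hf, hxe, ← hu₀]
    simp [tens, hl1]
  · intro b
    rw [← hK]
    exact ⟨fun h => ⟨b, h, rfl⟩, fun ⟨c, hc, e⟩ => by rwa [← show c = b from Subtype.ext e]⟩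
  · intro g b c hc
    rw [← act_eq_mulVec]
    exact hconj g b c hc

/-- A framed group is biextraspecial. -/
theorem isBiextraspecialWith [Q.Normal] [Finite Q] (F : Framing Q q) {m : ℕ}
    (hm : Nat.card U = 2 ^ m) : IsBiextraspecialWith Q m where
  card_eq := by rw [F.card_eq, hm]; ring
  comm_mem x hx y hy := by
    rw [F.mem_Z_iff]
    refine ⟨mul_mem (mul_mem (mul_mem hx hy) (inv_mem hx)) (inv_mem hy), ?_⟩
    change F.coord (⟨x, hx⟩ * ⟨y, hy⟩ * ⟨x, hx⟩⁻¹ * ⟨y, hy⟩⁻¹) = 1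
    rw [map_mul, map_mul, map_mul, map_inv, map_inv, mul_inv_cancel_comm, mul_inv_cancel]
  sq_mem x hx := by
    rw [F.mem_Z_iff]
    refine ⟨pow_mem hx 2, ?_⟩
    change F.coord (⟨x, hx⟩ ^ 2) = 1
    rw [map_pow, pow_two]
    exact add_self_eq_zero' (F.coord ⟨x, hx⟩).toAdd
  exists_proj := by
    refine ⟨F.proj, F.proj_surj, F.ker_proj, ?_, fun A B hA hB hZ hQ h => F.isNaturalSection hA hB hZ hQ h⟩
    have hmem (v) : (F.cen v : G) ∈ Z Q := (F.range_cen _).2 ⟨v.toAdd, rfl⟩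
    let e : Multiplicative NatMod ≃* Z Q := MulEquiv.ofBijective
      (MonoidHom.mk' (fun v => (⟨F.cen v, hmem v⟩ : Z Q)) (fun v v' => by
        apply Subtype.ext; simp))
      ⟨fun v v' h => by
        have h' : (⟨F.cen v, hmem v⟩ : Z Q) = ⟨F.cen v', hmem v'⟩ := h
        exact F.cen_inj (Subtype.ext (Subtype.mk.inj h')), fun x => by
        obtain ⟨v, hv⟩ := (F.range_cen ⟨x, Z_le Q x.2⟩).1 x.2
        exact ⟨.ofAdd v, Subtype.ext (show (F.cen (.ofAdd v) : G) = x by rw [hv])⟩⟩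
    have he (v : NatMod) : (e (.ofAdd v) : G) = F.cen (.ofAdd v) := rfl
    refine ⟨e.symm.toMonoidHom, e.symm.surjective, fun b => ?_, fun g b c hc => ?_⟩
    · rw [Subgroup.mem_bot, OneMemClass.coe_eq_one]
      exact e.symm.map_eq_one_iff
    · obtain ⟨v, rfl⟩ := e.surjective b
      have : c = e (.ofAdd (act (F.proj g) v.toAdd)) := by
        apply Subtype.ext
        rw [hc, he, F.cen_conj]; rfl
      rw [this, ← act_eq_mulVec]
      change (e.symm (e _)).toAdd = act _ (e.symm (e _)).toAdd
      rw [e.symm_apply_apply, e.symm_apply_apply]; rfl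

end Framing

/-! ### Centre and conjugation in the model -/

/-- The model is framed. -/
def modelFraming {U : Type*} [AddCommGroup U] [Module (ZMod 2) U]
    (β : LinearMap.BilinForm (ZMod 2) U)
    (hβ : ∀ u, (∀ u', QuadraticMap.polar (LinearMap.BilinMap.toQuadraticMap β) u u' = 0) → u = 0) :
    Framing (SemidirectProduct.rightHom : Model β ⋊[Model.action β] L22 →* L22).ker
      (LinearMap.BilinMap.toQuadraticMap β) := by
  let Q := (SemidirectProduct.rightHom : Model β ⋊[Model.action β] L22 →* L22).ker
  have hr (x : Q) : (x : Model β ⋊[Model.action β] L22).right = 1 := x.2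
  let l (x : Q) : Model β := (x : Model β ⋊[Model.action β] L22).left
  have hl (x y : Q) : l (x * y) = l x * l y := by
    change (x * y : Model β ⋊[Model.action β] L22).left = _
    rw [SemidirectProduct.mul_left, hr, map_one]; rfl
  let i (m : Model β) : Q := ⟨SemidirectProduct.inl m, rfl⟩
  have hli (m) : l (i m) = m := rfl
  have hli_inj : Function.Injective l := fun x y h =>
    Subtype.ext (SemidirectProduct.ext h ((hr x).trans (hr y).symm))
  -- This is where nondegeneracy enters. Commuting with elements over (0, u') and (u', 0) puts the
  -- coordinates 0 and 1 of a central element, respectively, into the radical of the polar form.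
  have hcenter (x : Q) : (x : Model β ⋊[Model.action β] L22) ∈ Z Q ↔ (l x).vec = 0 := by
    rw [coe_mem_Z_iff, Subgroup.mem_center_iff]
    constructor
    · intro h
      have hc (w : Fin 2 → U) : cocycle β w (l x).vec = cocycle β (l x).vec w := by
        have := congrArg (fun y => (l y).cen) (h (i ⟨w, 0⟩))
        simp only [hl, hli, Model.mul_cen, zero_add, add_zero] at this
        exact add_left_cancel this
      have hpol (u u' : U) : QuadraticMap.polar (LinearMap.BilinMap.toQuadraticMap β) u u' =
          β u u' + β u' u := by
        rw [LinearMap.BilinMap.polar_toQuadraticMap]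
      have h0 : (l x).vec 0 = 0 := hβ _ fun u' => by
        have := congrFun (hc ![0, u']) 0
        simp only [cocycle, Matrix.cons_val_zero, Matrix.cons_val_one, Matrix.cons_val_fin_one, map_zero,
          LinearMap.zero_apply, zero_add, add_zero] at this
        rw [hpol, this, add_self_eq_zero']
      have h1 : (l x).vec 1 = 0 := hβ _ fun u' => by
        have := congrFun (hc ![u', 0]) 1
        simp only [cocycle, Matrix.cons_val_zero, Matrix.cons_val_one, Matrix.cons_val_fin_one, map_zero,
          LinearMap.zero_apply, zero_add, add_zero] at this
        rw [hpol, this, add_self_eq_zero']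
      ext j; fin_cases j
      · exact h0
      · exact h1
    · intro h y
      apply hli_inj
      rw [hl, hl]
      ext1
      · simp [h]
      · simp [h, add_comm]
  have hconj' (g : Model β ⋊[Model.action β] L22) (x : Q) :
      (g * x * g⁻¹).left = g.left * Model.action β g.right (l x) * g.left⁻¹ := by
    simp only [SemidirectProduct.mul_left, SemidirectProduct.inv_left, SemidirectProduct.mul_right,
      hr, mul_one, ← MulAut.mul_apply, ← map_mul, mul_inv_cancel, map_one]
    rfl
  have hconj (g : Model β ⋊[Model.action β] L22) (x : Q) :
      (g * x * g⁻¹).left.vec = act g.right (l x).vec := by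
    rw [hconj', Model.mul_vec, Model.mul_vec, Model.action_apply, Model.inv_vec]
    have := add_self_eq_zero' g.left.vec
    rw [add_right_comm, this, zero_add]
  refine
    { proj := SemidirectProduct.rightHom
      proj_surj := SemidirectProduct.rightHom_surjective
      ker_proj := rfl
      coord := MonoidHom.mk' (fun x => .ofAdd (l x).vec) (fun x y => by
        rw [hl, Model.mul_vec, ofAdd_add])
      coord_surj := fun w => ⟨i ⟨w.toAdd, 0⟩, rfl⟩
      coord_conj := fun g x y h => ?_
      coord_eq_one_iff := fun x => (hcenter x).symm
      cen := MonoidHom.mk' (fun v => i ⟨0, v.toAdd⟩) (fun v v' => by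
        apply hli_inj
        rw [hl]
        ext1 <;> simp [hli])
      cen_inj := fun v v' h => congrArg (fun x => Multiplicative.ofAdd (l x).cen) h
      cen_conj := fun g v => ?_
      range_cen := fun x => ?_
      mul_self := fun x => ?_ }
  · change (l y).vec = act g.right (l x).vec
    rw [← hconj, ← h]
  · apply SemidirectProduct.ext
    · change (⟨0, act g.right v⟩ : Model β) = (g * (i ⟨0, v⟩ : Q) * g⁻¹).left
      rw [hconj', hli]
      ext1
      · have := add_self_eq_zero' g.left.vec
        simp [Model.action_apply, act_zero, this]
      · have := add_self_eq_zero' (g.left.cen + cocycle β g.left.vec g.left.vec)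
        simp only [Model.mul_cen, Model.mul_vec, Model.action_apply, Model.inv_cen, Model.inv_vec,
          act_zero, cocycle_zero_right, add_zero]
        refine (zero_add _).symm.trans ?_
        rw [← this]
        abel
    · simp [i]
  · rw [hcenter]
    constructor
    · intro h
      refine ⟨(l x).cen, hli_inj ?_⟩
      exact Model.ext h.symm rfl
    · rintro ⟨v, rfl⟩
      rfl
  · apply hli_inj
    rw [hl]
    ext1
    · exact add_self_eq_zero' _
    · change (l x).cen + (l x).cen + cocycle β (l x).vec (l x).vec =
        sqMap (LinearMap.BilinMap.toQuadraticMap β) (l x).vec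
      rw [add_self_eq_zero', zero_add, cocycle_self]

/-! ### Dents and the dent space in coordinates -/

/-- A finite group of exponent two is determined by its order. -/
theorem nonempty_mulEquiv_of_sq_eq_one {D : Type*} [Group D] (h : ∀ x : D, x * x = 1) {n : ℕ}
    (hn : Nat.card D = 2 ^ n) : Nonempty (D ≃* Multiplicative (Fin n → ZMod 2)) := by
  let _ : CommGroup D :=
    { (inferInstance : Group D) with
      mul_comm := fun x y => by
        have h' (x : D) : x⁻¹ = x := inv_eq_of_mul_eq_one_left (h x)
        rw [← h' (x * y), mul_inv_rev, h', h'] }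
  let _ : Module (ZMod 2) (Additive D) := AddCommGroup.zmodModule (n := 2) fun x => by
    rw [two_nsmul]; exact h x.toMul
  have : Finite (Additive D) := Nat.finite_of_card_ne_zero (α := D) (by rw [hn]; positivity)
  have hr : Module.finrank (ZMod 2) (Additive D) = n := by
    have h1 := Module.natCard_eq_pow_finrank (K := ZMod 2) (V := Additive D)
    rw [Nat.card_zmod, show Nat.card (Additive D) = 2 ^ n from hn] at h1
    exact (Nat.pow_right_injective le_rfl h1).symm
  have e : Additive D ≃ₗ[ZMod 2] (Fin n → ZMod 2) :=
    LinearEquiv.ofFinrankEq _ _ (by rw [hr, Module.finrank_fin_fun])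
  exact ⟨AddEquiv.toMultiplicativeRight e.toAddEquiv⟩

theorem tens_single_ne_zero : (![1, 0] : NatMod) ≠ 0 := by decide

namespace Framing

variable {G : Type*} [Group G] {Q : Subgroup G} {U : Type*} [AddCommGroup U]
  [Module (ZMod 2) U] {q : QuadraticForm (ZMod 2) U}

/-- The subgroup of elements with coordinates in the tensor product of the natural module with the
span of `u`. -/
def dentSub (F : Framing Q q) (u : U) : Subgroup G where
  carrier := {x | ∃ (hx : x ∈ Q) (v : NatMod), (F.coord ⟨x, hx⟩).toAdd = tens v u}
  one_mem' := ⟨one_mem Q, 0, by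
    change (F.coord 1).toAdd = _
    rw [map_one]; ext i; simp [tens]⟩
  mul_mem' := by
    rintro x y ⟨hx, v, hv⟩ ⟨hy, v', hv'⟩
    refine ⟨mul_mem hx hy, v + v', ?_⟩
    change (F.coord (⟨x, hx⟩ * ⟨y, hy⟩)).toAdd = _
    rw [map_mul, toAdd_mul, hv, hv', tens_add]
  inv_mem' := by
    rintro x ⟨hx, v, hv⟩
    refine ⟨inv_mem hx, v, ?_⟩
    change (F.coord (⟨x, hx⟩⁻¹)).toAdd = _
    rw [map_inv, toAdd_inv, hv, neg_eq_self']

theorem mem_dentSub (F : Framing Q q) (u : U) (x : Q) :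
    (x : G) ∈ F.dentSub u ↔ ∃ v, (F.coord x).toAdd = tens v u :=
  ⟨fun ⟨_, h⟩ => h, fun h => ⟨x.2, h⟩⟩

theorem dentSub_le (F : Framing Q q) (u : U) : F.dentSub u ≤ Q := fun _ ⟨h, _⟩ => h

theorem Z_le_dentSub (F : Framing Q q) (u : U) : Z Q ≤ F.dentSub u := by
  intro x hx
  obtain ⟨hxQ, h⟩ := (F.mem_Z_iff x).1 hx
  refine ⟨hxQ, 0, ?_⟩
  rw [h]; ext i; simp [tens]

theorem exists_mem_dentSub (F : Framing Q q) (u : U) (v : NatMod) :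
    ∃ x : Q, (x : G) ∈ F.dentSub u ∧ (F.coord x).toAdd = tens v u := by
  obtain ⟨x, hx⟩ := F.coord_surj (.ofAdd (tens v u))
  have : (F.coord x).toAdd = tens v u := by rw [hx]; rfl
  exact ⟨x, (F.mem_dentSub u x).2 ⟨v, this⟩, this⟩

theorem dentSub_normal [hQ : Q.Normal] (F : Framing Q q) (u : U) : (F.dentSub u).Normal := by
  refine ⟨?_⟩
  rintro x ⟨hx, v, hv⟩ g
  refine ⟨hQ.conj_mem x hx g, act (F.proj g) v, ?_⟩
  rw [F.coord_conj g ⟨x, hx⟩ _ rfl, hv, act_tens]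

theorem Z_lt_dentSub (F : Framing Q q) {u : U} (hu : u ≠ 0) : Z Q < F.dentSub u := by
  refine lt_of_le_of_ne (F.Z_le_dentSub u) fun e => ?_
  obtain ⟨x, hx, hxe⟩ := F.exists_mem_dentSub u ![1, 0]
  rw [← e, ← F.coord_eq_one_iff] at hx
  rw [hx] at hxe
  exact tens_single_ne_zero ((tens_eq_zero_iff hu).1 hxe.symm)

theorem dentSub_le_of_mem [Q.Normal] (F : Framing Q q) {N : Subgroup G} (hN : N.Normal)
    (hZ : Z Q ≤ N) {u : U} {v : NatMod} (hv : v ≠ 0) (h : tens v u ∈ F.image N) :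
    F.dentSub u ≤ N := by
  rintro y ⟨hy, v', hv'⟩
  rw [← F.coord_mem_image hZ ⟨y, hy⟩, hv']
  exact F.tens_mem_image_of_ne hN hv h

/-- Irreducibility comes from transitivity of L₂(2) on nonzero vectors. The condition `hU` serves
only to make the dent proper in `Q`. -/
theorem isDent_dentSub [Q.Normal] (F : Framing Q q) (hU : ∀ u : U, ∃ u', u' ≠ 0 ∧ u' ≠ u) {u : U}
    (hu : u ≠ 0) : IsDent Q (F.dentSub u) where
  normal := F.dentSub_normal u
  irreducible := by
    refine ⟨F.Z_lt_dentSub hu, fun N hN hZ hND => ?_⟩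
    by_cases h : N ≤ Z Q
    · exact Or.inl (le_antisymm h hZ)
    · right
      obtain ⟨x, hxN, hxZ⟩ := SetLike.not_le_iff_exists.1 h
      obtain ⟨hxQ, v, hv⟩ := hND hxN
      refine le_antisymm hND (F.dentSub_le_of_mem hN hZ (v := v) ?_ ⟨⟨x, hxQ⟩, hxN, hv⟩)
      rintro rfl
      apply hxZ
      rw [F.mem_Z_iff]
      refine ⟨hxQ, ?_⟩
      have : tens 0 u = 0 := (tens_eq_zero_iff hu).2 rfl
      rw [this] at hv
      exact hv
  lt := by
    refine lt_of_le_of_ne (F.dentSub_le u) fun e => ?_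
    obtain ⟨u', hu', hne⟩ := hU u
    obtain ⟨x, -, hx⟩ := F.exists_mem_dentSub u' ![1, 0]
    obtain ⟨v, hv⟩ := (F.mem_dentSub u x).1 (e.symm ▸ x.2)
    have h := congrFun (hx.symm.trans hv) 0
    rcases zmod_two_cases (v 0) with h0 | h0
    · exact hu' (by simpa [tens, h0] using h)
    · exact hne (by simpa [tens, h0] using h)

theorem eq_dentSub_of_isDent [Q.Normal] (F : Framing Q q) {D : Subgroup G} (hD : IsDent Q D) :
    ∃ u, u ≠ 0 ∧ D = F.dentSub u := by
  obtain ⟨hZD, hirr⟩ := hD.irreducible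
  obtain ⟨x, hxD, hxZ⟩ := SetLike.exists_of_lt hZD
  have hxQ := hD.lt.le hxD
  have hne : (F.coord ⟨x, hxQ⟩).toAdd ≠ 0 := fun h => hxZ ((F.mem_Z_iff x).2 ⟨hxQ, h⟩)
  obtain ⟨i, hi⟩ := Function.ne_iff.1 hne
  refine ⟨_, hi, ?_⟩
  have hle := F.dentSub_le_of_mem hD.normal hZD.le tens_single_ne_zero
    (F.tens_mem_image hD.normal ((F.coord_mem_image hZD.le ⟨x, hxQ⟩).2 hxD) i ![1, 0])
  exact ((hirr _ (F.dentSub_normal _) (F.Z_le_dentSub _) hle).resolve_left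
    (F.Z_lt_dentSub hi).ne').symm

theorem eq_of_tens_mem (F : Framing Q q) {u u' : U} (hu : u ≠ 0) {x : Q}
    (hx : (F.coord x).toAdd = tens ![1, 0] u) (h : (x : G) ∈ F.dentSub u') : u = u' := by
  obtain ⟨v, hv⟩ := (F.mem_dentSub u' x).1 h
  have h := congrFun (hx.symm.trans hv) 0
  rcases zmod_two_cases (v 0) with h0 | h0
  · exact absurd (by simpa [tens, h0] using h) hu
  · simpa [tens, h0] using h

theorem dentSub_injective (F : Framing Q q) {u u' : U} (hu : u ≠ 0)
    (h : F.dentSub u = F.dentSub u') : u = u' := by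
  obtain ⟨x, hx, hxe⟩ := F.exists_mem_dentSub u ![1, 0]
  exact F.eq_of_tens_mem hu hxe (h ▸ hx)

theorem card_dentSub [Finite Q] (F : Framing Q q) {u : U} (hu : u ≠ 0) :
    Nat.card (F.dentSub u) = 2 ^ 4 := by
  choose s hs hse using F.exists_mem_dentSub u
  have hcen (v : NatMod) : (F.cen (.ofAdd v) : G) ∈ F.dentSub u :=
    F.Z_le_dentSub u ((F.range_cen _).2 ⟨v, rfl⟩)
  let f (a : NatMod × NatMod) : F.dentSub u :=
    ⟨(s a.1 * F.cen (.ofAdd a.2) : Q), mul_mem (hs _) (hcen _)⟩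
  have hf : Function.Bijective f := by
    constructor
    · rintro ⟨v, z⟩ ⟨v', z'⟩ h
      have h1 : s v * F.cen (.ofAdd z) = s v' * F.cen (.ofAdd z') :=
        Subtype.ext (Subtype.mk.inj h)
      have h2 := congrArg F.coord h1
      rw [map_mul, map_mul, F.coord_cen, F.coord_cen, mul_one, mul_one] at h2
      have h3 : tens (v + v') u = 0 := by
        rw [tens_add, ← hse v, ← hse v', h2, add_self_eq_zero']
      obtain rfl := eq_of_add_eq_zero' ((tens_eq_zero_iff hu).1 h3)
      rw [show z = z' from F.cen_inj (mul_left_cancel h1)]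
    · rintro ⟨x, hx, v, hv⟩
      have h1 : F.coord ((s v)⁻¹ * ⟨x, hx⟩) = 1 := by
        rw [map_mul, map_inv, inv_mul_eq_one]
        exact (hse v).trans hv.symm
      obtain ⟨z, hz⟩ := (F.range_cen _).1 ((F.coord_eq_one_iff _).1 h1)
      refine ⟨(v, z), Subtype.ext ?_⟩
      change ((s v * F.cen (.ofAdd z) : Q) : G) = x
      rw [hz, mul_inv_cancel_left]
  rw [← Nat.card_congr (Equiv.ofBijective f hf)]
  simp

/-- An element over v ⊗ u squares to the central element of q(u)v, so the dent has exponent two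
exactly when q(u) = 0; its order is 16 in any case. -/
theorem isSingular_dentSub [Finite Q] (F : Framing Q q) {u : U} (hu : u ≠ 0) :
    IsSingular (F.dentSub u) ↔ q u = 0 := by
  constructor
  · rintro ⟨e⟩
    obtain ⟨x, hx, hxe⟩ := F.exists_mem_dentSub u ![1, 0]
    have h1 : (⟨x, hx⟩ * ⟨x, hx⟩ : F.dentSub u) = 1 := by
      apply e.injective
      rw [map_mul, map_one]
      exact add_self_eq_zero' (e ⟨x, hx⟩).toAdd
    have h2 : x * x = 1 := Subtype.ext (show (x : G) * x = 1 from congrArg Subtype.val h1)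
    rw [F.mul_self, hxe, sqMap_tens] at h2
    have h3 := F.cen_inj (h2.trans (map_one F.cen).symm)
    have h4 := congrFun (show (fun i => (![1, 0] : NatMod) i * q u) = 0 from h3) 0
    simpa using h4
  · intro h
    refine nonempty_mulEquiv_of_sq_eq_one ?_ (F.card_dentSub hu)
    rintro ⟨x, hx, v, hv⟩
    apply Subtype.ext
    change ((⟨x, hx⟩ * ⟨x, hx⟩ : Q) : G) = 1
    rw [F.mul_self, hv, sqMap_tens, h]
    simp only [mul_zero]
    exact congrArg Subtype.val (map_one F.cen)

/-- The isomorphism of the natural module with `D / Z` for a dent `D`. -/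
theorem exists_bar_equiv [hQ : Q.Normal] (F : Framing Q q) {u : U} (hu : u ≠ 0) :
    ∃ e : Multiplicative NatMod ≃* bar Q (F.dentSub u),
      (∀ (x : Q) (v : NatMod), (F.coord x).toAdd = tens v u →
        (e (.ofAdd v) : G ⧸ Z Q) = ((x : G) : G ⧸ Z Q)) ∧
      ∀ (g : G) (v : NatMod), (e (.ofAdd (act (F.proj g) v)) : G ⧸ Z Q) =
        (g : G ⧸ Z Q) * (e (.ofAdd v) : G ⧸ Z Q) * (g : G ⧸ Z Q)⁻¹ := by
  choose s hs hse using F.exists_mem_dentSub u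
  have heq (x y : Q) : ((x : G) : G ⧸ Z Q) = ((y : G) : G ⧸ Z Q) ↔ F.coord x = F.coord y := by
    rw [QuotientGroup.eq, ← inv_mul_eq_one, ← map_inv, ← map_mul, F.coord_eq_one_iff]; rfl
  let f : Multiplicative NatMod →* bar Q (F.dentSub u) := MonoidHom.mk'
    (fun v => ⟨((s v.toAdd : G) : G ⧸ Z Q), ⟨_, hs _, rfl⟩⟩) (fun v v' => by
      apply Subtype.ext
      change ((s (v.toAdd + v'.toAdd) : G) : G ⧸ Z Q) = ((s v.toAdd * s v'.toAdd : Q) : G)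
      rw [heq, map_mul]
      change (F.coord _).toAdd = (F.coord _).toAdd + (F.coord _).toAdd
      rw [hse, hse, hse, tens_add])
  have hf (v : NatMod) : (f (.ofAdd v) : G ⧸ Z Q) = ((s v : G) : G ⧸ Z Q) := rfl
  have hfx (x : Q) (v : NatMod) (hv : (F.coord x).toAdd = tens v u) :
      (f (.ofAdd v) : G ⧸ Z Q) = ((x : G) : G ⧸ Z Q) := by
    rw [hf, heq]
    exact (hse v).trans hv.symm
  refine ⟨MulEquiv.ofBijective f ⟨(injective_iff_map_eq_one f).2 fun v hv => ?_, ?_⟩, hfx, ?_⟩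
  · have h1 : ((s v.toAdd : G) : G ⧸ Z Q) = (((1 : Q) : G) : G ⧸ Z Q) := congrArg Subtype.val hv
    rw [heq, map_one] at h1
    have h2 := hse v.toAdd
    rw [h1] at h2
    exact (tens_eq_zero_iff hu).1 h2.symm
  · rintro ⟨_, x, ⟨hxQ, v, hv⟩, rfl⟩
    refine ⟨.ofAdd v, Subtype.ext ?_⟩
    change ((s v : G) : G ⧸ Z Q) = (((⟨x, hxQ⟩ : Q) : G) : G ⧸ Z Q)
    rw [heq]
    exact (hse v).trans hv.symm
  · intro g v
    change (f _ : G ⧸ Z Q) = _ * (f _ : G ⧸ Z Q) * _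
    rw [hfx _ v (hse v), hfx ⟨_, hQ.conj_mem _ (s v).2 g⟩ (act (F.proj g) v)]
    · rfl
    · rw [F.coord_conj g _ _ rfl, hse, act_tens]

theorem isDiagonal_dentSub [hQ : Q.Normal] (F : Framing Q q) {u u' : U} (hu : u ≠ 0) (hu' : u' ≠ 0) :
    IsDiagonal Q (F.dentSub u) (F.dentSub u') (F.dentSub (u + u')) := by
  obtain ⟨e, he, hec⟩ := F.exists_bar_equiv hu
  obtain ⟨e', he', hec'⟩ := F.exists_bar_equiv hu'
  have heq (x y : Q) : ((x : G) : G ⧸ Z Q) = ((y : G) : G ⧸ Z Q) ↔ F.coord x = F.coord y := by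
    rw [QuotientGroup.eq, ← inv_mul_eq_one, ← map_inv, ← map_mul, F.coord_eq_one_iff]; rfl
  refine ⟨e.symm.trans e', fun g x y h => ?_, fun d => ?_⟩
  · obtain ⟨v, rfl⟩ := e.surjective x
    have : y = e (.ofAdd (act (F.proj g) v.toAdd)) := by
      apply Subtype.ext
      rw [h, hec]; rfl
    rw [this]
    simp only [MulEquiv.trans_apply, MulEquiv.symm_apply_apply]
    rw [hec']; rfl
  · have hadd (v : NatMod) : tens v (u + u') = tens v u + tens v u' := by
      ext i; simp [tens]
    constructor
    · rintro ⟨hd, v, hv⟩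
      refine ⟨e (.ofAdd v), ?_⟩
      simp only [MulEquiv.trans_apply, MulEquiv.symm_apply_apply]
      obtain ⟨x, -, hx⟩ := F.exists_mem_dentSub u v
      obtain ⟨y, -, hy⟩ := F.exists_mem_dentSub u' v
      rw [he x v hx, he' y v hy]
      refine (heq ⟨d, hd⟩ (x * y)).2 ?_
      change (F.coord _).toAdd = (F.coord _).toAdd
      rw [hv, map_mul, toAdd_mul, hx, hy, hadd]
    · rintro ⟨x, hx⟩
      obtain ⟨v, rfl⟩ := e.surjective x
      simp only [MulEquiv.trans_apply, MulEquiv.symm_apply_apply] at hx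
      obtain ⟨x, -, hxe⟩ := F.exists_mem_dentSub u v.toAdd
      obtain ⟨y, -, hye⟩ := F.exists_mem_dentSub u' v.toAdd
      have h1 := he x _ hxe
      have h2 := he' y _ hye
      rw [ofAdd_toAdd] at h1 h2
      rw [h1, h2] at hx
      have hd : d ∈ Q := by
        have h3 : ((x * y : Q) : G)⁻¹ * d ∈ Z Q := QuotientGroup.eq.1 hx.symm
        have h4 := mul_mem (x * y).2 (Z_le Q h3)
        rwa [mul_inv_cancel_left] at h4
      refine ⟨hd, v.toAdd, ?_⟩
      have h4 := (heq ⟨d, hd⟩ (x * y)).1 hx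
      rw [h4, map_mul, toAdd_mul, hxe, hye, hadd]

/-- The isomorphism in the diagonal is arbitrary here, but it must match the unique nonzero
`tau`-fixed vectors of the two dents. So the diagonal contains the first basis vector tensored with
u + u', which identifies its coefficient. -/
theorem eq_of_isDiagonal [hQ : Q.Normal] (F : Framing Q q) {u u' u'' : U} (hu : u ≠ 0)
    (hu' : u' ≠ 0) (hne : u ≠ u')
    (h : IsDiagonal Q (F.dentSub u) (F.dentSub u') (F.dentSub u'')) : u + u' = u'' := by
  obtain ⟨φ, hφ, hmem⟩ := h
  obtain ⟨e, he, hec⟩ := F.exists_bar_equiv hu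
  obtain ⟨e', he', hec'⟩ := F.exists_bar_equiv hu'
  have h10 : act tau ![1, 0] = (![1, 0] : NatMod) := by decide
  obtain ⟨g, hg⟩ := F.proj_surj tau
  obtain ⟨v, hv⟩ := e'.surjective (φ (e (.ofAdd ![1, 0])))
  have h1 := hec g ![1, 0]
  rw [hg, h10] at h1
  have h2 := hφ g _ _ h1
  rw [← hv] at h2
  have h3 := hec' g v.toAdd
  rw [ofAdd_toAdd, ← h2, hg] at h3
  have h4 : act tau v.toAdd = v.toAdd := e'.injective (Subtype.ext h3)
  have h5 : v.toAdd ≠ 0 := by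
    intro h
    have h6 : v = 1 := h
    rw [h6, map_one, eq_comm, map_eq_one_iff φ φ.injective, map_eq_one_iff e e.injective] at hv
    exact tens_single_ne_zero hv
  have key : ∀ v : NatMod, act tau v = v → v ≠ 0 → v = ![1, 0] := by decide
  have h6 := key _ h4 h5
  obtain ⟨x, -, hx⟩ := F.exists_mem_dentSub u ![1, 0]
  obtain ⟨y, -, hy⟩ := F.exists_mem_dentSub u' ![1, 0]
  have h7 : ((x * y : Q) : G) ∈ F.dentSub u'' := by
    refine (hmem _).2 ⟨e (.ofAdd ![1, 0]), ?_⟩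
    rw [← hv, ← ofAdd_toAdd v, h6, he x _ hx, he' y _ hy]; rfl
  refine F.eq_of_tens_mem (x := x * y) (fun h => hne (eq_of_add_eq_zero' h)) ?_ h7
  rw [map_mul, toAdd_mul, hx, hy]
  ext i; simp [tens]

/-- The dent space of a framed group. -/
theorem exists_dentSpace_equiv [Q.Normal] [Finite Q] (F : Framing Q q)
    (hU : ∀ u : U, ∃ u', u' ≠ 0 ∧ u' ≠ u) :
    ∃ e : U ≃ DentSpace Q, (∀ u v X, IsSum Q (e u) (e v) X ↔ X = e (u + v)) ∧
      ∀ u, dentForm Q (e u) = q u := by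
  classical
  let f (u : U) : DentSpace Q := if hu : u = 0 then none else some ⟨F.dentSub u, F.isDent_dentSub hU hu⟩
  have hf0 : f 0 = none := dif_pos rfl
  have hf (u : U) (hu : u ≠ 0) : f u = some ⟨F.dentSub u, F.isDent_dentSub hU hu⟩ := dif_neg hu
  have hbij : Function.Bijective f := by
    constructor
    · intro u v h
      by_cases hu : u = 0 <;> by_cases hv : v = 0
      · rw [hu, hv]
      · rw [hu, hf0, hf v hv] at h; cases h
      · rw [hv, hf0, hf u hu] at h; cases h
      · rw [hf u hu, hf v hv] at h
        exact F.dentSub_injective hu (congrArg Subtype.val (Option.some.inj h))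
    · rintro (_ | ⟨D, hD⟩)
      · exact ⟨0, hf0⟩
      · obtain ⟨u, hu, rfl⟩ := F.eq_dentSub_of_isDent hD
        exact ⟨u, hf u hu⟩
  refine ⟨Equiv.ofBijective f hbij, fun u v X => ?_, fun u => ?_⟩
  · simp only [Equiv.ofBijective_apply]
    by_cases hu : u = 0
    · rw [hu, hf0, zero_add]; rfl
    by_cases hv : v = 0
    · rw [hv, hf0, add_zero, hf u hu]; rfl
    obtain ⟨w, rfl⟩ := hbij.2 X
    rw [hf u hu, hf v hv]
    by_cases hw : w = 0
    · rw [hw, hf0]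
      change (⟨F.dentSub u, _⟩ : {D : Subgroup G // IsDent Q D}) = ⟨F.dentSub v, _⟩ ↔ _
      constructor
      · intro h
        rw [F.dentSub_injective hu (Subtype.mk.inj h), add_self_eq_zero', hf0]
      · intro h
        rw [← hf0] at h
        obtain rfl := eq_of_add_eq_zero' (hbij.1 h).symm
        rfl
    · rw [hf w hw]
      change (⟨F.dentSub u, _⟩ : {D : Subgroup G // IsDent Q D}) ≠ ⟨F.dentSub v, _⟩ ∧
        IsDiagonal Q (F.dentSub u) (F.dentSub v) (F.dentSub w) ↔ _
      rw [← hf w hw, hbij.1.eq_iff]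
      constructor
      · rintro ⟨hne, h⟩
        refine (F.eq_of_isDiagonal hu hv ?_ h).symm
        rintro rfl
        exact hne rfl
      · rintro rfl
        refine ⟨fun h => hw ?_, F.isDiagonal_dentSub hu hv⟩
        rw [F.dentSub_injective hu (Subtype.mk.inj h), add_self_eq_zero']
  · simp only [Equiv.ofBijective_apply]
    by_cases hu : u = 0
    · rw [hu, hf0, map_zero]; rfl
    · rw [hf u hu]
      change (if IsSingular (F.dentSub u) then 0 else 1) = q u
      rw [F.isSingular_dentSub hu]
      rcases zmod_two_cases (q u) with h | h <;> simp [h]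

/-- Change of the space of a framing along an isometry. -/
def comap (F : Framing Q q) {V : Type*} [AddCommGroup V] [Module (ZMod 2) V]
    (q' : QuadraticForm (ZMod 2) V) (f : V ≃ₗ[ZMod 2] U) (hf : ∀ v, q (f v) = q' v) :
    Framing Q q' where
  proj := F.proj
  proj_surj := F.proj_surj
  ker_proj := F.ker_proj
  coord := MonoidHom.mk' (fun x => .ofAdd fun i => f.symm ((F.coord x).toAdd i)) (fun x y => by
    rw [← ofAdd_add]
    congr 1
    ext i
    simp)
  coord_surj w := by
    obtain ⟨x, hx⟩ := F.coord_surj (.ofAdd fun i => f (w.toAdd i))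
    refine ⟨x, ?_⟩
    change (fun i => f.symm ((F.coord x).toAdd i)) = w.toAdd
    rw [hx]
    ext i
    simp
  coord_conj g x y h := by
    change (fun i => f.symm ((F.coord y).toAdd i)) = act _ (fun i => f.symm ((F.coord x).toAdd i))
    rw [F.coord_conj g x y h]
    ext i
    simp [act]
  coord_eq_one_iff x := by
    rw [← F.coord_eq_one_iff]
    constructor
    · intro h
      change (F.coord x).toAdd = 0
      ext i
      have := congrFun (show (fun i => f.symm ((F.coord x).toAdd i)) = 0 from h) i
      simpa using this
    · intro h
      change (fun i => f.symm ((F.coord x).toAdd i)) = 0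
      rw [h]
      ext i
      simp
  cen := F.cen
  cen_inj := F.cen_inj
  cen_conj := F.cen_conj
  range_cen := F.range_cen
  mul_self x := by
    rw [F.mul_self]
    congr 2
    change sqMap q (F.coord x).toAdd = sqMap q' (fun i => f.symm ((F.coord x).toAdd i))
    ext i
    simp [sqMap, QuadraticMap.polar, ← hf]

end Framing

/-! ### Uniqueness and existence for a given form -/

theorem exists_ne_zero_ne {U : Type*} [AddCommGroup U] (hU : 2 < Nat.card U) (u : U) :
    ∃ u', u' ≠ 0 ∧ u' ≠ u := by
  classical
  have : Finite U := Nat.finite_of_card_ne_zero (by omega)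
  have : Fintype U := Fintype.ofFinite U
  by_contra! h
  have h1 : (Finset.univ : Finset U) ⊆ {0, u} := fun x _ => by
    by_cases hx : x = 0
    · simp [hx]
    · simp [h x hx]
  have h2 := Finset.card_le_card h1
  rw [Finset.card_univ, ← Nat.card_eq_fintype_card] at h2
  exact absurd (h2.trans Finset.card_le_two) (by omega)

/-- A biextraspecial group is determined by its rank and the quadratic form of its dent space. -/
theorem IsBiextraspecialWith.nonempty_mulEquiv {G : Type*} [Group G] {Q : Subgroup G} [Q.Normal]
    {m : ℕ} (h : IsBiextraspecialWith Q m) (hm : 2 ≤ m) {V : Type} [AddCommGroup V]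
    [Module (ZMod 2) V] {β : LinearMap.BilinForm (ZMod 2) V}
    (hV : DentSpaceIsometric Q (LinearMap.BilinMap.toQuadraticMap β)) :
    Nat.card V = 2 ^ m ∧ Nonempty (Model β ⋊[Model.action β] L22 ≃* G) := by
  have := h.finite
  obtain ⟨U, i1, i2, q, ⟨F⟩⟩ := h.exists_framing
  have hcard : Nat.card U = 2 ^ m := by
    have h1 := F.card_eq
    rw [h.card_eq] at h1
    have h2 : (2 ^ m) ^ 2 = Nat.card U ^ 2 := by
      have : 2 ^ (2 + 2 * m) = 4 * (2 ^ m) ^ 2 := by ring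
      omega
    exact (Nat.pow_left_injective two_ne_zero h2).symm
  have hlt : 2 < Nat.card U := by
    rw [hcard]
    calc 2 < 2 ^ 2 := by norm_num
      _ ≤ 2 ^ m := Nat.pow_le_pow_right two_pos hm
  obtain ⟨e, hsum, hform⟩ := F.exists_dentSpace_equiv (exists_ne_zero_ne hlt)
  obtain ⟨e₀, hsum₀, hform₀⟩ := hV
  let f : V ≃+ U := AddEquiv.mk' (e₀.trans e.symm) fun u v => by
    simp only [Equiv.trans_apply]
    -- In a framed group the sum relation is exactly the graph of addition, so a bijection
    -- respecting it is additive.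
    rw [Equiv.symm_apply_eq, ← hsum]
    simpa using hsum₀ u v
  let f' : V ≃ₗ[ZMod 2] U :=
    { f with map_smul' := fun c x => ZMod.map_smul f c x }
  have hf (v : V) : e (f' v) = e₀ v := e.apply_symm_apply _
  refine ⟨by rw [Nat.card_congr f'.toEquiv, hcard], ?_⟩
  refine (F.comap (LinearMap.BilinMap.toQuadraticMap β) f' fun v => ?_).nonempty_mulEquiv β rfl
  rw [← hform, hf, hform₀]

/-- One bilinear form with diagonal `q` is chosen for both groups, so both are isomorphic to the
same model. -/
theorem nonempty_mulEquiv_of_isometric {G H : Type*} [Group G] [Group H] {Q : Subgroup G} [Q.Normal]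
    {R : Subgroup H} [R.Normal] {m : ℕ} (hm : 2 ≤ m) (hQ : IsBiextraspecialWith Q m)
    (hR : IsBiextraspecialWith R m) {V : Type} [AddCommGroup V] [Module (ZMod 2) V]
    {q : QuadraticForm (ZMod 2) V} (hq : DentSpaceIsometric Q q) (hq' : DentSpaceIsometric R q) :
    Nonempty (G ≃* H) := by
  obtain ⟨β, rfl⟩ := LinearMap.BilinMap.toQuadraticMap_surjective q
  obtain ⟨e⟩ := (hQ.nonempty_mulEquiv hm hq).2
  obtain ⟨e'⟩ := (hR.nonempty_mulEquiv hm hq').2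
  exact ⟨e.symm.trans e'⟩

/-- Every nondegenerate quadratic form is the form of the dent space of a biextraspecial group. -/
theorem exists_isBiextraspecialWith {V : Type} [AddCommGroup V] [Module (ZMod 2) V]
    (q : QuadraticForm (ZMod 2) V) (hq : ∀ u, (∀ u', QuadraticMap.polar q u u' = 0) → u = 0)
    {m : ℕ} (hm : 2 ≤ m) (hV : Nat.card V = 2 ^ m) :
    ∃ (G : Type) (_ : Group G) (Q : Subgroup G) (_ : Q.Normal),
      IsBiextraspecialWith Q m ∧ DentSpaceIsometric Q q := by
  obtain ⟨β, rfl⟩ := LinearMap.BilinMap.toQuadraticMap_surjective q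
  let F := modelFraming β hq
  have hlt : 2 < Nat.card V := by
    rw [hV]
    calc 2 < 2 ^ 2 := by norm_num
      _ ≤ 2 ^ m := Nat.pow_le_pow_right two_pos hm
  have : Finite V := Nat.finite_of_card_ne_zero (by omega)
  have : Finite (Model β) := Finite.of_injective (fun x => (x.vec, x.cen)) fun x y h =>
    Model.ext (congrArg Prod.fst h) (congrArg Prod.snd h)
  have : Finite (Model β ⋊[Model.action β] L22) := Finite.of_equiv _ SemidirectProduct.equivProd.symm
  obtain ⟨e, hsum, hform⟩ := F.exists_dentSpace_equiv (exists_ne_zero_ne hlt)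
  exact ⟨_, _, _, inferInstance, F.isBiextraspecialWith hV, e,
    fun u v => (hsum u v _).2 rfl, hform⟩

/-! ### The two types of forms -/

theorem hyperbolicPlane_polar (x : Plane) (h : ∀ y, QuadraticMap.polar hyperbolicPlane x y = 0) :
    x = 0 := by
  have key : ∀ x : Plane, (∀ y : Plane, (x + y).1 * (x + y).2 - x.1 * x.2 - y.1 * y.2 = 0) → x = 0 := by
    decide
  exact key x h

theorem anisotropicPlane_polar (x : Plane)
    (h : ∀ y, QuadraticMap.polar anisotropicPlane x y = 0) : x = 0 := by
  have key : ∀ x : Plane, (∀ y : Plane,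
      ((x + y).1 * (x + y).1 + (x + y).1 * (x + y).2 + (x + y).2 * (x + y).2) -
        (x.1 * x.1 + x.1 * x.2 + x.2 * x.2) - (y.1 * y.1 + y.1 * y.2 + y.2 * y.2) = 0) → x = 0 := by
    decide
  exact key x h

theorem hyperbolicSum_polar {k : ℕ} (x : Fin k → Plane)
    (h : ∀ y, QuadraticMap.polar (hyperbolicSum k) x y = 0) : x = 0 := by
  funext i
  refine hyperbolicPlane_polar _ fun y => ?_
  have h1 := h (Pi.single i y)
  rw [hyperbolicSum, QuadraticMap.Ring.polar_pi, Finset.sum_eq_single i] at h1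
  · simpa using h1
  · intro j _ hj
    rw [Pi.single_eq_of_ne hj]
    exact QuadraticMap.polar_zero_right _ _
  · simp

theorem hyperbolicSum_prod_polar {k : ℕ} (x : (Fin k → Plane) × Plane)
    (h : ∀ y, QuadraticMap.polar ((hyperbolicSum k).prod anisotropicPlane) x y = 0) : x = 0 := by
  refine Prod.ext (hyperbolicSum_polar _ fun y => ?_) (anisotropicPlane_polar _ fun y => ?_)
  · simpa using h (y, 0)
  · simpa using h (0, y)

theorem card_hyperbolicSum (k : ℕ) : Nat.card (Fin k → Plane) = 2 ^ (2 * k) := by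
  rw [Nat.card_fun]; simp [pow_mul]

theorem card_hyperbolicSum_prod (k : ℕ) : Nat.card ((Fin k → Plane) × Plane) = 2 ^ (2 * (k + 1)) := by
  rw [Nat.card_prod, card_hyperbolicSum]; simp; ring

/-- The type leaves the number of planes open; comparing the order of the dent space with 2^m
determines it. -/
theorem IsBiextraspecial.exists_plus {G : Type*} [Group G] {m : ℕ} (hm : 2 ≤ m)
    (h : IsBiextraspecial G m .plus) : ∃ (Q : Subgroup G) (_ : Q.Normal),
      IsBiextraspecialWith Q m ∧ DentSpaceIsometric Q (hyperbolicSum (m / 2)) := by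
  obtain ⟨Q, hQ, h, k, hk⟩ := h
  obtain ⟨β, hβ⟩ := LinearMap.BilinMap.toQuadraticMap_surjective (hyperbolicSum k)
  have h1 := (h.nonempty_mulEquiv hm (hβ ▸ hk)).1
  rw [card_hyperbolicSum] at h1
  have h2 := Nat.pow_right_injective le_rfl h1
  obtain rfl : k = m / 2 := by omega
  exact ⟨Q, hQ, h, hk⟩

theorem IsBiextraspecial.exists_minus {G : Type*} [Group G] {m : ℕ} (hm : 2 ≤ m)
    (h : IsBiextraspecial G m .minus) : ∃ (Q : Subgroup G) (_ : Q.Normal),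
      IsBiextraspecialWith Q m ∧
        DentSpaceIsometric Q ((hyperbolicSum (m / 2 - 1)).prod anisotropicPlane) := by
  obtain ⟨Q, hQ, h, k, hk⟩ := h
  obtain ⟨β, hβ⟩ := LinearMap.BilinMap.toQuadraticMap_surjective
    ((hyperbolicSum k).prod anisotropicPlane)
  have h1 := (h.nonempty_mulEquiv hm (hβ ▸ hk)).1
  rw [card_hyperbolicSum_prod] at h1
  have h2 := Nat.pow_right_injective le_rfl h1
  obtain rfl : k = m / 2 - 1 := by omega
  exact ⟨Q, hQ, h, hk⟩

theorem exists_isBiextraspecial {m : ℕ} (hm : 2 ≤ m) (heven : Even m) (ε : FormType) :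
    ∃ (G : Type) (_ : Group G), IsBiextraspecial G m ε := by
  obtain ⟨k, rfl⟩ := heven
  cases ε with
  | plus =>
    obtain ⟨G, i, Q, hQ, h, h'⟩ := exists_isBiextraspecialWith (hyperbolicSum k)
      hyperbolicSum_polar hm (by rw [card_hyperbolicSum, two_mul])
    exact ⟨G, i, Q, hQ, h, k, h'⟩
  | minus =>
    -- One of the m/2 planes is the anisotropic one, which leaves m/2 - 1 hyperbolic planes.
    obtain ⟨k, rfl⟩ : ∃ j, k = j + 1 := ⟨k - 1, by omega⟩
    obtain ⟨G, i, Q, hQ, h, h'⟩ := exists_isBiextraspecialWith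
      ((hyperbolicSum k).prod anisotropicPlane) hyperbolicSum_prod_polar hm
      (by rw [card_hyperbolicSum_prod, two_mul])
    exact ⟨G, i, Q, hQ, h, k, h'⟩

end Biextraspecial

theorem mainTheorem2 (m : ℕ) (hpos : 0 < m) (heven : Even m)
    (ε : Biextraspecial.FormType) :
    (∃ (G : Type) (_ : Group G), Biextraspecial.IsBiextraspecial G m ε) ∧
    ∀ (G : Type*) (H : Type*) [Group G] [Group H],
      Biextraspecial.IsBiextraspecial G m ε → Biextraspecial.IsBiextraspecial H m ε →
        Nonempty (G ≃* H) := by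
  have hm : 2 ≤ m := by
    obtain ⟨k, rfl⟩ := heven
    omega
  refine ⟨Biextraspecial.exists_isBiextraspecial hm heven ε, fun G H _ _ hG hH => ?_⟩
  cases ε with
  | plus =>
    obtain ⟨Q, _, hQ, hq⟩ := hG.exists_plus hm
    obtain ⟨R, _, hR, hq'⟩ := hH.exists_plus hm
    exact Biextraspecial.nonempty_mulEquiv_of_isometric hm hQ hR hq hq'
  | minus =>
    obtain ⟨Q, _, hQ, hq⟩ := hG.exists_minus hm
    obtain ⟨R, _, hR, hq'⟩ := hH.exists_minus hm
    exact Biextraspecial.nonempty_mulEquiv_of_isometric hm hQ hR hq hq'
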